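/- All graphs are finite and simple. A strong $k$-edge-coloring of a graph $G$ is a map $E(G)\to\{1,\dots,k\}$ giving different colors to any two distinct edges at distance at most $2$ (distance being measured in the line graph of $G$); the strong chromatic index $\chi'_s(G)$ is the least $k$ for which such a coloring exists. Let $$\sigma(G)=\max_{xy\in E(G)}\{\deg(x)+\deg(y)-1\},$$ let $\Delta(G)$ be the maximum degree, and let $\operatorname{mad}(G)=\max_{H}\frac{2|E(H)|}{|V(H)|}$, the maximum being over all nonempty subgraphs $H$ of $G$. The odd (even) girth of $G$ is the length of a shortest odd (even) cycle of $G$, and $\infty$ if there is none. For an integer $\sigma\ge 5$ put $$g'_\sigma=\begin{cases}9,&\sigma=5,\\ \sigma,&\sigma>5,\end{cases}\qquad \ell_\sigma=\begin{cases}8,&\sigma=5,\\ 7,&\sigma=6,7,\\ \sigma,&\sigma\ge 8.\end{cases}$$ **Theorem.** Let $G$ be a graph with $\sigma=\sigma(G)\ge 5$, $\sigma\ge\Delta(G)+2$, odd girth at least $g'_\sigma$, even girth at least $6$, and $$\operatorname{mad}(G)<2+\frac{2}{3\ell_\sigma-1}.$$ Then $\chi'_s(G)=\sigma$. -/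

import Mathlib

namespace StrongEdge

open SimpleGraph

variable {V : Type*}

/-- A strong `k`-edge-coloring: a map from the edges to `k` colors such that any two distinct
edges at distance at most two (measured in the line graph) receive different colors. The extended
distance is used, so that edges in different components are at distance `⊤`. -/
def IsStrongEdgeColoring (G : SimpleGraph V) {k : ℕ} (c : G.edgeSet → Fin k) : Prop :=
  ∀ e f : G.edgeSet, e ≠ f → G.lineGraph.edist e f ≤ 2 → c e ≠ c f

/-- The strong chromatic index: the least `k` such that there is a strong `k`-edge-coloring
(`⊤` if there is none, which cannot happen for finite graphs). -/
noncomputable def strongChromaticIndex (G : SimpleGraph V) : ℕ∞ :=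
  ⨅ k ∈ {k : ℕ | ∃ c : G.edgeSet → Fin k, IsStrongEdgeColoring G c}, (k : ℕ∞)

/-- `σ(G)`, the maximum of `deg x + deg y - 1` over the edges `xy` of `G` (`0` if there is no edge).
The truncated subtraction is harmless since both degrees are positive. -/
def sigma [Fintype V] (G : SimpleGraph V) [DecidableRel G.Adj] : ℕ :=
  (Finset.univ.filter fun p : V × V => G.Adj p.1 p.2).sup
    fun p => G.degree p.1 + G.degree p.2 - 1

/-- The length of a shortest odd cycle, `⊤` if there is no odd cycle. -/
noncomputable def oddGirth (G : SimpleGraph V) : ℕ∞ :=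
  ⨅ (a : V) (w : G.Walk a a) (_ : w.IsCycle) (_ : Odd w.length), (w.length : ℕ∞)

/-- The length of a shortest even cycle, `⊤` if there is no even cycle. -/
noncomputable def evenGirth (G : SimpleGraph V) : ℕ∞ :=
  ⨅ (a : V) (w : G.Walk a a) (_ : w.IsCycle) (_ : Even w.length), (w.length : ℕ∞)

/-- The maximum average degree of a finite graph: the maximum of `2|E(H)| / |V(H)|` over the
subgraphs `H`. The supremum is over finitely many subgraphs; the empty subgraph contributes
`0 / 0 = 0`, which does not affect the maximum because all terms are nonnegative. -/
noncomputable def mad [Finite V] (G : SimpleGraph V) : ℝ :=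
  ⨆ H : G.Subgraph, 2 * (H.edgeSet.ncard : ℝ) / (H.verts.ncard : ℝ)

/-- `ℓ_σ` (meaningful for `σ ≥ 5`). -/
def ell (s : ℕ) : ℕ :=
  if s = 5 then 8 else if s = 6 ∨ s = 7 then 7 else s

/-- `g'_σ` (meaningful for `σ ≥ 5`). -/
def gPrime (s : ℕ) : ℕ :=
  if s = 5 then 9 else s

end StrongEdge

/-! Lower bound: the `deg x + deg y - 1` edges meeting an edge `xy` are pairwise at distance at most
two, so σ colors are needed (`IsStrongEdgeColoring.deg_add_deg_le`).

Upper bound: induction on the number of edges, with the hypotheses in the hereditary form `Sparse`.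
A pendant edge at a vertex with at most one non-leaf neighbor sees at most σ - 1 colors and can be
colored last (`IsLocalColoring.extend_leaf`). If there is no such edge, the vertices of degree at
least two span a graph of minimum degree at least two (`core`), and the density bound forces ℓ
consecutive vertices of core degree two (`exists_thread`). They form a thread or run around a cycle
(`thread_or_cycle`). Delete the edges inside this thread and the pendant edges at it, color the rest
by induction, and extend (`IsLocalColoring.extend_thread`).

Extending means choosing color sets E_i at the thread vertices, of size at least the degree, such
that consecutive sets share exactly the color of the edge between them; the two end sets A, B and
the end colors a, b are given. When |E_i| + |E_{i+1}| = σ + 1 throughout, E_{i+2} arises from E_i by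
exchanging one color, which explains why ℓ grows with σ.

The last free set has to meet B in b only. So a set matters only through its numbers of colors in B
\ {b} (targets), equal to b (last) and elsewhere (others), together with the kind of the color
through which it was entered. `Winning` lists good positions by the number of remaining steps,
`winning_step` continues a good position, and `hasNextVia_winning_ell` and `winning_closed` show
that threads and cycles start in good positions. -/

namespace StrongEdge

/-! ### The counting game along a thread -/

/-- The three kinds of colors seen from the far end of a thread whose last end-vertex carries the
color set `insert z T`: the colors of `T`, the color `z`, and all others. -/
inductive Kind
  | target
  | other
  | last

/-- A sufficient condition, depending on the number `k` of remaining steps, for a color set with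
`p` target colors, `q` other colors and `z` last colors, entered through a color of kind `h`, to be
extendable to the far end. Here `τ` and `ν` are the total numbers of target and other colors. -/
def Winning (τ ν : ℕ) : ℕ → ℕ → ℕ → ℕ → Kind → Prop
  -- The final set avoids the targets and contains the last color, which must still be free as an
  -- exit.
  | 0, p, _, z, .target => p = 0 ∧ z = 1
  | 0, p, _, z, .other => p = 0 ∧ z = 1
  | 0, _, _, _, .last => False
  | 1, p, q, z, .target => z = 0 ∧ (p = τ ∨ q = 1) ∧ 1 ≤ q
  | 1, p, q, z, _ => z = 0 ∧ (p = τ ∨ q = 1) ∧ 2 ≤ q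
  | 2, p, q, z, .target => z = 1 ∧ q + 1 ≤ ν ∧ (p = 1 ∨ q + 1 = ν) ∧ 2 ≤ p
  | 2, p, q, z, _ => z = 1 ∧ q + 1 ≤ ν ∧ (p = 1 ∨ q + 1 = ν) ∧ 1 ≤ p
  | 3, p, q, z, h => (z = 0 ∧ p + 1 ≤ τ ∧ 2 ≤ q ∧ (q = 2 ∨ p + 1 = τ)) ∨
      (z = 0 ∧ p + 1 ≤ τ ∧ q = 1 ∧ h = .target) ∨
      (z = 1 ∧ h ≠ .last ∧ p + 1 ≤ τ ∧ 1 ≤ q ∧ (p + 1 = τ ∨ q = 1))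
  | 4, p, q, z, h => (z = 1 ∧ 1 ≤ p ∧ q + 1 ≤ ν ∧ (p ≤ 2 ∨ ν ≤ q + 2) ∧
      ¬ (h = .other ∧ p = 1 ∧ q = 1)) ∨
      (z = 0 ∧ (p ≤ 2 ∨ ν ≤ q + 1) ∧ ¬ (h = .other ∧ p = 0))
  | 5, p, q, z, h => (z = 1 ∧ (q ≤ 2 ∨ τ ≤ p + 2)) ∨
      (z = 0 ∧ (q ≤ 3 ∨ τ ≤ p + 2) ∧ ¬ (h = .target ∧ q = 0) ∧
        ¬ (τ = 2 ∧ p = 1 ∧ h = .target ∧ q = ν))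
  -- Apart from one small exception, from here on the thresholds loosen by one every two steps. With
  -- an even number of steps left few targets are wanted, with an odd number many.
  | 6, p, q, z, h => (p ≤ 3 ∨ ν ≤ q + z + 2) ∧ ¬ (τ = 2 ∧ p = 2 ∧ q = 0 ∧ z = 1 ∧ h = .last)
  | k + 7, p, q, z, _ => if Even k then q + z ≤ k / 2 + 4 ∨ τ ≤ p + k / 2 + 3
      else p ≤ k / 2 + 4 ∨ ν ≤ q + z + k / 2 + 3

/-- A set with `p`, `q`, `z` colors of the three kinds, entered through kind `h`, can be followed by
a set with `d` colors satisfying `P`. -/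
def HasNext (τ ν d : ℕ) (P : ℕ → ℕ → ℕ → Kind → Prop) (p q z : ℕ) (h : Kind) : Prop :=
  (p ≥ (match h with | .target => 2 | _ => 1) ∧ ∃ a b e, a + p ≤ τ ∧ b + q ≤ ν ∧ e + z ≤ 1 ∧
    a + b + e + 1 = d ∧ P (a + 1) b e .target) ∨
  (q ≥ (match h with | .other => 2 | _ => 1) ∧ ∃ a b e, a + p ≤ τ ∧ b + q ≤ ν ∧ e + z ≤ 1 ∧
    a + b + e + 1 = d ∧ P a (b + 1) e .other) ∨
  (z ≥ (match h with | .last => 2 | _ => 1) ∧ ∃ a b e, a + p ≤ τ ∧ b + q ≤ ν ∧ e + z ≤ 1 ∧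
    a + b + e + 1 = d ∧ P a b (e + 1) .last)

section
variable {τ ν d p q z : ℕ} {h : Kind}

/-- This and the following steps try extremal candidates and leave the check to linear arithmetic.
Before an even number of remaining steps the next set takes few targets: at most `ν - q` new others
exist, so the truncated difference `d - 1 - (ν - q)` (or `d - 2 - (ν - q)` when the last color is
added too) is the least possible number. Before an odd number it takes many, up to `min (τ - p) (d -
1)`. Here the final set consists of the exit color, the last color and others. -/
theorem winning_step_zero (hd : 3 ≤ d) (hE : 3 ≤ p + q + z) (hsum : p + q + z + d ≤ τ + ν + 2)
    (hp : p ≤ τ) (hz : z ≤ 1) (hhp : h = .target → 1 ≤ p) (hhq : h = .other → 1 ≤ q)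
    (hhz : h = .last → 1 ≤ z) (hdν : d ≤ ν + 1) (hW : Winning τ ν 1 p q z h) :
    HasNext τ ν d (Winning τ ν 0) p q z h := by
  by_contra hne
  simp only [HasNext, not_or, not_and, not_exists] at hne
  obtain ⟨hT, hN, hL⟩ := hne
  obtain rfl | rfl : z = 0 ∨ z = 1 := by omega
  · cases h
    · have h0 := fun pf => hN pf 0 (d - 2 - 0) 1
      simp [Winning] at h0 hW hhp hhq hhz
      omega
    · have h0 := fun pf => hN pf 0 (d - 2 - 0) 1
      simp [Winning] at h0 hW hhp hhq hhz
      omega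
    · simp [Winning] at hW hhz
  · cases h <;> simp [Winning] at hW hhz

theorem winning_step_one (hτ : 2 ≤ τ) (hd : 3 ≤ d) (hE : 3 ≤ p + q + z)
    (hsum : p + q + z + d ≤ τ + ν + 2) (hp : p ≤ τ) (hz : z ≤ 1) (hhp : h = .target → 1 ≤ p)
    (hhq : h = .other → 1 ≤ q) (hhz : h = .last → 1 ≤ z) (hW : Winning τ ν 2 p q z h) :
    HasNext τ ν d (Winning τ ν 1) p q z h := by
  by_contra hne
  simp only [HasNext, not_or, not_and, not_exists] at hne
  obtain ⟨hT, hN, hL⟩ := hne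
  obtain rfl | rfl : z = 0 ∨ z = 1 := by omega
  · cases h <;> simp [Winning] at hW hhz
  · cases h
    · have h0 := fun pf => hT pf (d - 1 - (ν - q)) (d - 1 - (d - 1 - (ν - q))) 0
      simp [Winning] at h0 hW hhp hhq hhz
      omega
    · have h0 := fun pf => hT pf (min (τ - p) (d - 1)) (d - 1 - (min (τ - p) (d - 1))) 0
      -- One target is given up in case the greedy choice leaves no other color to exit through.
      have h1 := fun pf => hT pf (min (τ - p) (d - 1) - 1) (d - 1 - (min (τ - p) (d - 1) - 1)) 0
      simp [Winning] at h0 h1 hW hhp hhq hhz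
      omega
    · have h0 := fun pf => hT pf (min (τ - p) (d - 1)) (d - 1 - (min (τ - p) (d - 1))) 0
      have h1 := fun pf => hT pf (min (τ - p) (d - 1) - 1) (d - 1 - (min (τ - p) (d - 1) - 1)) 0
      simp [Winning] at h0 h1 hW hhp hhq hhz
      omega

theorem winning_step_two (hν : 2 ≤ ν) (hd : 3 ≤ d) (hE : 3 ≤ p + q + z)
    (hsum : p + q + z + d ≤ τ + ν + 2) (hds : d + 1 ≤ τ + ν) (hq : q ≤ ν) (hz : z ≤ 1)
    (hhp : h = .target → 1 ≤ p) (hhq : h = .other → 1 ≤ q) (hhz : h = .last → 1 ≤ z)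
    (hW : Winning τ ν 3 p q z h) : HasNext τ ν d (Winning τ ν 2) p q z h := by
  by_contra hne
  simp only [HasNext, not_or, not_and, not_exists] at hne
  obtain ⟨hT, hN, hL⟩ := hne
  obtain rfl | rfl : z = 0 ∨ z = 1 := by omega
  · cases h
    · have h0 := fun pf => hN pf 1 (d - 2 - 1) 1
      have h1 := fun pf => hN pf (d - 2 - (ν - q)) (d - 2 - (d - 2 - (ν - q))) 1
      have h2 := fun pf => hT pf (d - 2 - (ν - q)) (d - 2 - (d - 2 - (ν - q))) 1
      simp [Winning] at h0 h1 h2 hW hhp hhq hhz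
      omega
    · have h0 := fun pf => hN pf 1 (d - 2 - 1) 1
      have h1 := fun pf => hN pf (d - 2 - (ν - q)) (d - 2 - (d - 2 - (ν - q))) 1
      simp [Winning] at h0 h1 hW hhp hhq hhz
      omega
    · simp [Winning] at hW hhz
  · cases h
    · have h0 := fun pf => hL pf 1 (d - 1 - 1) 0
      have h1 := fun pf => hL pf (d - 1 - (ν - q)) (d - 1 - (d - 1 - (ν - q))) 0
      simp [Winning] at h0 h1 hW hhp hhq hhz
      omega
    · have h0 := fun pf => hL pf 1 (d - 1 - 1) 0
      have h1 := fun pf => hL pf (d - 1 - (ν - q)) (d - 1 - (d - 1 - (ν - q))) 0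
      simp [Winning] at h0 h1 hW hhp hhq hhz
      omega
    · simp [Winning] at hW hhz

theorem winning_step_three (hν : 2 ≤ ν) (hτ : 2 ≤ τ) (hd : 3 ≤ d) (hE : 3 ≤ p + q + z)
    (hsum : p + q + z + d ≤ τ + ν + 2) (hds : d + 1 ≤ τ + ν) (hp : p ≤ τ) (hq : q ≤ ν)
    (hz : z ≤ 1) (hhp : h = .target → 1 ≤ p) (hhq : h = .other → 1 ≤ q) (hhz : h = .last → 1 ≤ z)
    (hW : Winning τ ν 4 p q z h) : HasNext τ ν d (Winning τ ν 3) p q z h := by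
  by_contra hne
  simp only [HasNext, not_or, not_and, not_exists] at hne
  obtain ⟨hT, hN, hL⟩ := hne
  obtain rfl | rfl : z = 0 ∨ z = 1 := by omega
  · cases h
    · have h0 := fun pf => hN pf (min (τ - p) (d - 2)) (d - 2 - (min (τ - p) (d - 2))) 1
      have h1 := fun pf => hT pf (min (τ - p) (d - 2)) (d - 2 - (min (τ - p) (d - 2))) 1
      simp [Winning] at h0 h1 hW hhp hhq hhz
      omega
    · have h0 := fun pf => hN pf (min (τ - p) (d - 2)) (d - 2 - (min (τ - p) (d - 2))) 1
      have h1 := fun pf => hT pf (min (τ - p) (d - 2)) (d - 2 - (min (τ - p) (d - 2))) 1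
      have h2 := fun pf => hT pf (min (τ - p) (d - 2) - 1) (d - 2 - (min (τ - p) (d - 2) - 1)) 1
      simp [Winning] at h0 h1 h2 hW hhp hhq hhz
      omega
    · simp [Winning] at hW hhz
  · cases h
    · have h0 := fun pf => hN pf (min (τ - p) (d - 1)) (d - 1 - (min (τ - p) (d - 1))) 0
      have h1 := fun pf => hN pf (min (τ - p) (d - 1) - 1) (d - 1 - (min (τ - p) (d - 1) - 1)) 0
      have h2 := fun pf => hT pf (min (τ - p) (d - 1)) (d - 1 - (min (τ - p) (d - 1))) 0
      have h3 := fun pf => hT pf (min (τ - p) (d - 1) - 1) (d - 1 - (min (τ - p) (d - 1) - 1)) 0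
      simp [Winning] at h0 h1 h2 h3 hW hhp hhq hhz
      omega
    · have h0 := fun pf => hN pf (min (τ - p) (d - 1)) (d - 1 - (min (τ - p) (d - 1))) 0
      have h1 := fun pf => hT pf (min (τ - p) (d - 1)) (d - 1 - (min (τ - p) (d - 1))) 0
      have h2 := fun pf => hT pf (min (τ - p) (d - 1) - 1) (d - 1 - (min (τ - p) (d - 1) - 1)) 0
      simp [Winning] at h0 h1 h2 hW hhp hhq hhz
      omega
    · have h0 := fun pf => hN pf (min (τ - p) (d - 1)) (d - 1 - (min (τ - p) (d - 1))) 0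
      have h1 := fun pf => hT pf (min (τ - p) (d - 1)) (d - 1 - (min (τ - p) (d - 1))) 0
      have h2 := fun pf => hT pf (min (τ - p) (d - 1) - 1) (d - 1 - (min (τ - p) (d - 1) - 1)) 0
      simp [Winning] at h0 h1 h2 hW hhp hhq hhz
      omega

theorem winning_step_four (hν : 2 ≤ ν) (hτ : 2 ≤ τ) (hd : 3 ≤ d) (hE : 3 ≤ p + q + z)
    (hsum : p + q + z + d ≤ τ + ν + 2) (hp : p ≤ τ) (hq : q ≤ ν) (hz : z ≤ 1)
    (hhp : h = .target → 1 ≤ p) (hhq : h = .other → 1 ≤ q) (hhz : h = .last → 1 ≤ z)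
    (hW : Winning τ ν 5 p q z h) : HasNext τ ν d (Winning τ ν 4) p q z h := by
  by_contra hne
  simp only [HasNext, not_or, not_and, not_exists] at hne
  obtain ⟨hT, hN, hL⟩ := hne
  obtain rfl | rfl : z = 0 ∨ z = 1 := by omega
  · cases h
    · have h0 := fun pf => hN pf 1 (d - 1 - 1) 0
      have h1 := fun pf => hN pf 2 (d - 1 - 2) 0
      have h2 := fun pf => hN pf (d - 2 - (ν - q)) (d - 2 - (d - 2 - (ν - q))) 1
      have h3 := fun pf => hT pf (d - 2 - (ν - q)) (d - 2 - (d - 2 - (ν - q))) 1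
      simp [Winning] at h0 h1 h2 h3 hW hhp hhq hhz
      omega
    · have h0 := fun pf => hN pf 2 (d - 1 - 2) 0
      have h1 := fun pf => hN pf (d - 2 - (ν - q)) (d - 2 - (d - 2 - (ν - q))) 1
      have h2 := fun pf => hT pf (d - 2 - (ν - q)) (d - 2 - (d - 2 - (ν - q))) 1
      simp [Winning] at h0 h1 h2 hW hhp hhq hhz
      omega
    · simp [Winning] at hW hhz
  · cases h
    · have h0 := fun pf => hN pf 1 (d - 1 - 1) 0
      have h1 := fun pf => hN pf (d - 1 - (ν - q)) (d - 1 - (d - 1 - (ν - q))) 0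
      have h2 := fun pf => hT pf (d - 1 - (ν - q)) (d - 1 - (d - 1 - (ν - q))) 0
      simp [Winning] at h0 h1 h2 hW hhp hhq hhz
      omega
    · have h0 := fun pf => hN pf 1 (d - 1 - 1) 0
      have h1 := fun pf => hN pf (d - 1 - (ν - q)) (d - 1 - (d - 1 - (ν - q))) 0
      have h2 := fun pf => hT pf (d - 1 - (ν - q)) (d - 1 - (d - 1 - (ν - q))) 0
      simp [Winning] at h0 h1 h2 hW hhp hhq hhz
      omega
    · have h0 := fun pf => hN pf 1 (d - 1 - 1) 0
      have h1 := fun pf => hN pf (d - 1 - (ν - q)) (d - 1 - (d - 1 - (ν - q))) 0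
      have h2 := fun pf => hT pf (d - 1 - (ν - q)) (d - 1 - (d - 1 - (ν - q))) 0
      simp [Winning] at h0 h1 h2 hW hhp hhq hhz
      omega

theorem winning_step_five (hν : 2 ≤ ν) (hτ : 2 ≤ τ) (hd : 3 ≤ d) (hE : 3 ≤ p + q + z)
    (hsum : p + q + z + d ≤ τ + ν + 2) (hds : d + 1 ≤ τ + ν) (hp : p ≤ τ) (hq : q ≤ ν)
    (hz : z ≤ 1) (hhp : h = .target → 1 ≤ p) (hhq : h = .other → 1 ≤ q) (hhz : h = .last → 1 ≤ z)
    (hW : Winning τ ν 6 p q z h) : HasNext τ ν d (Winning τ ν 5) p q z h := by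
  by_contra hne
  simp only [HasNext, not_or, not_and, not_exists] at hne
  obtain ⟨hT, hN, hL⟩ := hne
  obtain rfl | rfl : z = 0 ∨ z = 1 := by omega
  · cases h
    · have h0 := fun pf => hN pf (min (τ - p) (d - 2)) (d - 2 - (min (τ - p) (d - 2))) 1
      have h1 := fun pf => hT pf (min (τ - p) (d - 2)) (d - 2 - (min (τ - p) (d - 2))) 1
      simp [Winning] at h0 h1 hW hhp hhq hhz
      omega
    · have h0 := fun pf => hN pf (min (τ - p) (d - 2)) (d - 2 - (min (τ - p) (d - 2))) 1
      have h1 := fun pf => hT pf (min (τ - p) (d - 2)) (d - 2 - (min (τ - p) (d - 2))) 1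
      simp [Winning] at h0 h1 hW hhp hhq hhz
      omega
    · simp [Winning] at hW hhz
  · cases h
    · have h0 := fun pf => hT pf (min (τ - p) (d - 1)) (d - 1 - (min (τ - p) (d - 1))) 0
      have h1 := fun pf => hL pf (min (τ - p) (d - 1)) (d - 1 - (min (τ - p) (d - 1))) 0
      simp [Winning] at h0 h1 hW hhp hhq hhz
      omega
    · have h0 := fun pf => hT pf (min (τ - p) (d - 1)) (d - 1 - (min (τ - p) (d - 1))) 0
      have h1 := fun pf => hL pf (min (τ - p) (d - 1)) (d - 1 - (min (τ - p) (d - 1))) 0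
      simp [Winning] at h0 h1 hW hhp hhq hhz
      omega
    · have h0 := fun pf => hN pf (min (τ - p) (d - 1)) (d - 1 - (min (τ - p) (d - 1))) 0
      have h1 := fun pf => hT pf (min (τ - p) (d - 1)) (d - 1 - (min (τ - p) (d - 1))) 0
      have h2 := fun pf => hT pf (min (τ - p) (d - 1) - 1) (d - 1 - (min (τ - p) (d - 1) - 1)) 0
      simp [Winning] at h0 h1 h2 hW hhp hhq hhz
      omega

end

section
variable {τ ν d p q z : ℕ} {h : Kind}

theorem winning_step_six (hd : 3 ≤ d) (hE : 3 ≤ p + q + z) (hsum : p + q + z + d ≤ τ + ν + 2)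
    (hds : d + 1 ≤ τ + ν) (hp : p ≤ τ) (hq : q ≤ ν) (hz : z ≤ 1) (hhp : h = .target → 1 ≤ p)
    (hhq : h = .other → 1 ≤ q) (hhz : h = .last → 1 ≤ z) (hW : Winning τ ν 7 p q z h) :
    HasNext τ ν d (Winning τ ν 6) p q z h := by
  by_contra hne
  simp only [HasNext, not_or, not_and, not_exists] at hne
  obtain ⟨hT, hN, hL⟩ := hne
  obtain rfl | rfl : z = 0 ∨ z = 1 := by omega
  · cases h
    · have h0 := fun pf => hN pf (d - 2 - (ν - q)) (d - 2 - (d - 2 - (ν - q))) 1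
      have h1 := fun pf => hT pf (d - 2 - (ν - q)) (d - 2 - (d - 2 - (ν - q))) 1
      simp [Winning] at h0 h1 hW hhp hhq hhz
      omega
    · have h0 := fun pf => hN pf (d - 2 - (ν - q)) (d - 2 - (d - 2 - (ν - q))) 1
      have h1 := fun pf => hT pf (d - 2 - (ν - q)) (d - 2 - (d - 2 - (ν - q))) 1
      simp [Winning] at h0 h1 hW hhp hhq hhz
      omega
    · simp at hhz
  · cases h
    · have h0 := fun pf => hL pf (d - 1 - (ν - q)) (d - 1 - (d - 1 - (ν - q))) 0
      simp [Winning] at h0 hW hhp hhq hhz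
      omega
    · have h0 := fun pf => hN pf 2 (d - 1 - 2) 0
      have h1 := fun pf => hL pf (d - 1 - (ν - q)) (d - 1 - (d - 1 - (ν - q))) 0
      simp [Winning] at h0 h1 hW hhp hhq hhz
      omega
    · have h0 := fun pf => hN pf (d - 1 - (ν - q)) (d - 1 - (d - 1 - (ν - q))) 0
      have h1 := fun pf => hT pf (d - 1 - (ν - q)) (d - 1 - (d - 1 - (ν - q))) 0
      simp [Winning] at h0 h1 hW hhp hhq hhz
      omega

theorem winning_step_add_seven (k : ℕ) (hd : 3 ≤ d) (hE : 3 ≤ p + q + z)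
    (hsum : p + q + z + d ≤ τ + ν + 2) (hp : p ≤ τ) (hq : q ≤ ν) (hz : z ≤ 1)
    (hhp : h = .target → 1 ≤ p) (hhq : h = .other → 1 ≤ q) (hhz : h = .last → 1 ≤ z)
    (hW : Winning τ ν (k + 8) p q z h) : HasNext τ ν d (Winning τ ν (k + 7)) p q z h := by
  by_contra hne
  simp only [HasNext, not_or, not_and, not_exists] at hne
  obtain ⟨hT, hN, hL⟩ := hne
  change Winning τ ν (k + 1 + 7) p q z h at hW
  obtain hk | hk := Nat.even_or_odd k
  · have hk1 : ¬ Even (k + 1) := by simpa [Nat.even_add_one] using hk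
    obtain ⟨m, rfl⟩ := hk
    obtain rfl | rfl : z = 0 ∨ z = 1 := by omega
    · cases h
      · have h0 := fun pf => hN pf (min (τ - p) (d - 2)) (d - 2 - (min (τ - p) (d - 2))) 1
        have h1 := fun pf => hT pf (min (τ - p) (d - 2)) (d - 2 - (min (τ - p) (d - 2))) 1
        simp [Winning, hk1] at h0 h1 hW hhp hhq hhz
        omega
      · have h0 := fun pf => hN pf (min (τ - p) (d - 2)) (d - 2 - (min (τ - p) (d - 2))) 1
        have h1 := fun pf => hT pf (min (τ - p) (d - 2)) (d - 2 - (min (τ - p) (d - 2))) 1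
        simp [Winning, hk1] at h0 h1 hW hhp hhq hhz
        omega
      · simp at hhz
    · cases h
      · have h0 := fun pf => hN pf (min (τ - p) (d - 1)) (d - 1 - (min (τ - p) (d - 1))) 0
        have h1 := fun pf => hT pf (min (τ - p) (d - 1)) (d - 1 - (min (τ - p) (d - 1))) 0
        simp [Winning, hk1] at h0 h1 hW hhp hhq hhz
        omega
      · have h0 := fun pf => hN pf (min (τ - p) (d - 1)) (d - 1 - (min (τ - p) (d - 1))) 0
        have h1 := fun pf => hT pf (min (τ - p) (d - 1)) (d - 1 - (min (τ - p) (d - 1))) 0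
        simp [Winning, hk1] at h0 h1 hW hhp hhq hhz
        omega
      · have h0 := fun pf => hN pf (min (τ - p) (d - 1)) (d - 1 - (min (τ - p) (d - 1))) 0
        have h1 := fun pf => hT pf (min (τ - p) (d - 1)) (d - 1 - (min (τ - p) (d - 1))) 0
        simp [Winning, hk1] at h0 h1 hW hhp hhq hhz
        omega
  · have hk1 : Even (k + 1) := hk.add_one
    have hk2 := Nat.not_even_iff_odd.2 hk
    obtain ⟨m, rfl⟩ := hk
    obtain rfl | rfl : z = 0 ∨ z = 1 := by omega
    · cases h
      · have h0 := fun pf => hN pf (d - 2 - (ν - q)) (d - 2 - (d - 2 - (ν - q))) 1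
        have h1 := fun pf => hT pf (d - 2 - (ν - q)) (d - 2 - (d - 2 - (ν - q))) 1
        simp [Winning, hk1, hk2] at h0 h1 hW hhp hhq hhz
        omega
      · have h0 := fun pf => hN pf (d - 2 - (ν - q)) (d - 2 - (d - 2 - (ν - q))) 1
        have h1 := fun pf => hT pf (d - 2 - (ν - q)) (d - 2 - (d - 2 - (ν - q))) 1
        simp [Winning, hk1, hk2] at h0 h1 hW hhp hhq hhz
        omega
      · simp at hhz
    · cases h
      · have h0 := fun pf => hL pf (d - 1 - (ν - q)) (d - 1 - (d - 1 - (ν - q))) 0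
        simp [Winning, hk1, hk2] at h0 hW hhp hhq hhz
        omega
      · have h0 := fun pf => hL pf (d - 1 - (ν - q)) (d - 1 - (d - 1 - (ν - q))) 0
        simp [Winning, hk1, hk2] at h0 hW hhp hhq hhz
        omega
      · have h0 := fun pf => hN pf (d - 1 - (ν - q)) (d - 1 - (d - 1 - (ν - q))) 0
        have h1 := fun pf => hT pf (d - 1 - (ν - q)) (d - 1 - (d - 1 - (ν - q))) 0
        simp [Winning, hk1, hk2] at h0 h1 hW hhp hhq hhz
        omega

theorem winning_step (k : ℕ) (hν : 2 ≤ ν) (hτ : 2 ≤ τ) (hd : 3 ≤ d) (hE : 3 ≤ p + q + z)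
    (hsum : p + q + z + d ≤ τ + ν + 2) (hds : d + 1 ≤ τ + ν) (hp : p ≤ τ) (hq : q ≤ ν)
    (hz : z ≤ 1) (hhp : h = .target → 1 ≤ p) (hhq : h = .other → 1 ≤ q) (hhz : h = .last → 1 ≤ z)
    (hdν : k = 0 → d ≤ ν + 1) (hW : Winning τ ν (k + 1) p q z h) :
    HasNext τ ν d (Winning τ ν k) p q z h := by
  match k with
  | 0 => exact winning_step_zero hd hE hsum hp hz hhp hhq hhz (hdν rfl) hW
  | 1 => exact winning_step_one hτ hd hE hsum hp hz hhp hhq hhz hW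
  | 2 => exact winning_step_two hν hd hE hsum hds hq hz hhp hhq hhz hW
  | 3 => exact winning_step_three hν hτ hd hE hsum hds hp hq hz hhp hhq hhz hW
  | 4 => exact winning_step_four hν hτ hd hE hsum hp hq hz hhp hhq hhz hW
  | 5 => exact winning_step_five hν hτ hd hE hsum hds hp hq hz hhp hhq hhz hW
  | 6 => exact winning_step_six hd hE hsum hds hp hq hz hhp hhq hhz hW
  | k + 7 => exact winning_step_add_seven k hd hE hsum hp hq hz hhp hhq hhz hW

end

/-! ### Starting positions of the game -/

section
variable {τ ν d p q z : ℕ} {h : Kind}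

/-- Starting from a set with `p`, `q`, `z` colors of the three kinds and an exit color of kind `h`,
there is a next set with `d` colors satisfying `P`. -/
def HasNextVia (τ ν d : ℕ) (P : ℕ → ℕ → ℕ → Kind → Prop) (p q z : ℕ) : Kind → Prop
  | .target => ∃ a b e, a + p ≤ τ ∧ b + q ≤ ν ∧ e + z ≤ 1 ∧ a + b + e + 1 = d ∧
      P (a + 1) b e .target
  | .other => ∃ a b e, a + p ≤ τ ∧ b + q ≤ ν ∧ e + z ≤ 1 ∧ a + b + e + 1 = d ∧
      P a (b + 1) e .other
  | .last => ∃ a b e, a + p ≤ τ ∧ b + q ≤ ν ∧ e + z ≤ 1 ∧ a + b + e + 1 = d ∧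
      P a b (e + 1) .last

/-- With `ell σ - 1` steps left almost every position is good, since failing both alternatives in
`Winning` would require more than σ colors. The one bad position, for σ = 6 or 7, has τ = 2 and
consists of both targets and the last color, entered through the last color. The inequality `hEτ`,
which says |A| ≤ |B|, leaves enough other colors to avoid it; this is why the fewest targets are
taken there. -/
theorem hasNextVia_winning_ell (hν : 2 ≤ ν) (hτ : 2 ≤ τ) (hd : 3 ≤ d)
    (hE : 3 ≤ p + q + z) (hEτ : p + q + z ≤ τ + 1)
    (hsum : p + q + z + d ≤ τ + ν + 2) (hds : d + 1 ≤ τ + ν) (hp : p ≤ τ) (hq : q ≤ ν) (hz : z ≤ 1)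
    (hhp : h = .target → 1 ≤ p) (hhq : h = .other → 1 ≤ q) (hhz : h = .last → 1 ≤ z) :
    HasNextVia τ ν d (Winning τ ν (ell (τ + ν + 1) - 1)) p q z h := by
  obtain hs | hs | hs : τ + ν + 1 = 5 ∨ (τ + ν + 1 = 6 ∨ τ + ν + 1 = 7) ∨ 8 ≤ τ + ν + 1 := by omega
  · obtain rfl : τ = 2 := by omega
    obtain rfl : ν = 2 := by omega
    have hl : ell (2 + 2 + 1) - 1 = 0 + 7 := by simp [ell]
    rw [hl]
    cases h <;> simp only [HasNextVia] <;>
      refine ⟨min (2 - p) (d - 1 - (1 - z)), d - 1 - (1 - z) - min (2 - p) (d - 1 - (1 - z)),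
        1 - z, ?_⟩ <;> simp [Winning] at * <;> omega
  · have hl : ell (τ + ν + 1) - 1 = 6 := by
      have : τ + ν + 1 ≠ 5 := by omega
      rw [ell, if_neg this, if_pos hs]
    rw [hl]
    cases h <;> simp only [HasNextVia]
    · refine ⟨min (τ - p) (d - 1 - (1 - z)), d - 1 - (1 - z) - min (τ - p) (d - 1 - (1 - z)),
        1 - z, ?_⟩
      simp [Winning] at *
      omega
    · refine ⟨min (τ - p) (d - 1 - (1 - z)), d - 1 - (1 - z) - min (τ - p) (d - 1 - (1 - z)),
        1 - z, ?_⟩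
      simp [Winning] at *
      omega
    · refine ⟨d - 1 - (ν - q), d - 1 - (d - 1 - (ν - q)), 0, ?_⟩
      simp [Winning] at *
      omega
  · obtain ⟨m, hm⟩ : ∃ m, τ + ν = m + 7 := ⟨τ + ν - 7, by omega⟩
    have hl : ell (τ + ν + 1) - 1 = m + 7 := by
      rw [ell, if_neg (by omega), if_neg (by omega)]
      omega
    rw [hl]
    obtain hk | hk := Nat.even_or_odd m
    · have hk' := hk
      obtain ⟨n, rfl⟩ := hk
      cases h <;> simp only [HasNextVia] <;>
      refine ⟨min (τ - p) (d - 1 - (1 - z)), d - 1 - (1 - z) - min (τ - p) (d - 1 - (1 - z)),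
        1 - z, ?_⟩ <;> simp [Winning, hk'] at * <;> omega
    · have hk' := Nat.not_even_iff_odd.2 hk
      obtain ⟨n, rfl⟩ := hk
      cases h <;> simp only [HasNextVia] <;>
      refine ⟨min (τ - p) (d - 1 - (1 - z)), d - 1 - (1 - z) - min (τ - p) (d - 1 - (1 - z)),
        1 - z, ?_⟩ <;> simp [Winning, hk'] at * <;> omega

/-- The position is A itself, entered through b: it has all the targets and no other color. For even
`n` that is what an odd number of remaining steps asks for. For odd `n` it is the wrong shape, and
the number of colors being at most `n` saves it; τ = 2 with `n = 7` is the exceptional position of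
`Winning`. -/
theorem winning_closed {n : ℕ} (hn : (Even n ∧ 6 ≤ n) ∨ (Odd n ∧ 7 ≤ n ∧ τ + ν + 1 ≤ n))
    (hn7 : n = 7 → 3 ≤ τ) : Winning τ ν (n - 1) τ 0 1 .last := by
  obtain rfl | rfl | hn8 : n = 6 ∨ n = 7 ∨ 8 ≤ n := by omega
  · simp [Winning]
  · have := hn7 rfl
    have h6 : ¬ Even 7 := by decide
    simp [Winning, h6] at *
    omega
  · obtain ⟨m, rfl⟩ : ∃ m, n = m + 8 := ⟨n - 8, by omega⟩
    have : m + 8 - 1 = m + 7 := rfl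
    rw [this]
    obtain hk | hk := Nat.even_or_odd m
    · simp only [Winning, hk, if_true]
      omega
    · have hk' := Nat.not_even_iff_odd.2 hk
      simp only [Winning, hk', if_false]
      obtain ⟨a, rfl⟩ := hk
      obtain ⟨⟨b, hb⟩, -⟩ | ⟨-, -, hb⟩ := hn <;> omega
end

/-! ### From counts to color sets -/

section
variable {C : Type*} [DecidableEq C]

/-- The kind of a color with respect to a target set and a last color. -/
def kindOf (T : Finset C) (z c : C) : Kind :=
  if c ∈ T then .target else if c = z then .last else .other

variable {T : Finset C} {z : C}

/-- The condition `P` on the numbers of colors of the three kinds in `E` and the kind of `h`. -/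
def OnCounts (T : Finset C) (z : C) (P : ℕ → ℕ → ℕ → Kind → Prop) (E : Finset C) (h : C) : Prop :=
  P (E ∩ T).card (E \ insert z T).card (E ∩ {z}).card (kindOf T z h)

theorem card_eq_add_add (hz : z ∉ T) (E : Finset C) :
    (E ∩ T).card + (E \ insert z T).card + (E ∩ {z}).card = E.card := by
  have h1 := Finset.card_inter_add_card_sdiff E (insert z T)
  have h2 : E ∩ insert z T = (E ∩ T) ∪ (E ∩ {z}) := by
    ext; simp; tauto
  have h3 : Disjoint (E ∩ T) (E ∩ {z}) := by
    rw [Finset.disjoint_left]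
    intro x hx hx'
    simp only [Finset.mem_inter, Finset.mem_singleton] at hx hx'
    exact hz (hx'.2 ▸ hx.2)
  rw [h2, Finset.card_union_of_disjoint h3] at h1
  omega

variable [Fintype C]

/-- The new set consists of `c` and arbitrary colors outside `E`, chosen separately in each of the
three classes. -/
theorem exists_next_set (hz : z ∉ T) {E : Finset C} {c : C} (hc : c ∈ E) {a b e : ℕ}
    (ha : a + (E ∩ T).card ≤ T.card) (hb : b + (E \ insert z T).card ≤ ((insert z T)ᶜ).card)
    (he : e + (E ∩ {z}).card ≤ 1) :
    ∃ E' : Finset C, c ∈ E' ∧ E ∩ E' = {c} ∧ E'.card = a + b + e + 1 ∧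
      (E' ∩ T).card = a + (if c ∈ T then 1 else 0) ∧
      (E' \ insert z T).card = b + (if c ∈ insert z T then 0 else 1) ∧
      (E' ∩ {z}).card = e + (if c = z then 1 else 0) := by
  have ha' : a ≤ (T \ E).card := by
    have := Finset.card_inter_add_card_sdiff T E
    rw [Finset.inter_comm] at this
    omega
  have hb' : b ≤ ((insert z T)ᶜ \ E).card := by
    have := Finset.card_inter_add_card_sdiff (insert z T)ᶜ E
    have h2 : (insert z T)ᶜ ∩ E = E \ insert z T := by ext; simp; tauto
    rw [h2] at this
    omega
  have he' : e ≤ ({z} \ E : Finset C).card := by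
    have := Finset.card_inter_add_card_sdiff {z} E
    rw [Finset.inter_comm, Finset.card_singleton] at this
    omega
  obtain ⟨A, hA, rfl⟩ := Finset.exists_subset_card_eq ha'
  obtain ⟨B, hB, rfl⟩ := Finset.exists_subset_card_eq hb'
  obtain ⟨Z, hZ, rfl⟩ := Finset.exists_subset_card_eq he'
  have hA' : ∀ x ∈ A, x ∈ T ∧ x ∉ E := fun x hx => by simpa using hA hx
  have hB' : ∀ x ∈ B, (x ≠ z ∧ x ∉ T) ∧ x ∉ E := fun x hx => by simpa using hB hx
  have hZ' : ∀ x ∈ Z, x = z ∧ x ∉ E := fun x hx => by simpa using hZ hx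
  have key : ∀ (S U : Finset C), c ∉ U → insert c (A ∪ B ∪ Z) ∩ S = U ∪ ({c} ∩ S) →
      (insert c (A ∪ B ∪ Z) ∩ S).card = U.card + (if c ∈ S then 1 else 0) := by
    intro S U hU h
    rw [h, Finset.card_union_of_disjoint]
    · split_ifs with hcS
      · rw [Finset.singleton_inter_of_mem hcS, Finset.card_singleton]
      · rw [Finset.singleton_inter_of_notMem hcS, Finset.card_empty]
    · rw [Finset.disjoint_left]
      intro x hx hx'
      simp only [Finset.mem_inter, Finset.mem_singleton] at hx'
      exact hU (hx'.1 ▸ hx)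
  have hcA : c ∉ A := fun h => (hA' c h).2 hc
  have hcB : c ∉ B := fun h => (hB' c h).2 hc
  have hcZ : c ∉ Z := fun h => (hZ' c h).2 hc
  have h1 : (insert c (A ∪ B ∪ Z) ∩ T).card = A.card + (if c ∈ T then 1 else 0) := by
    refine key T A hcA ?_
    ext x
    have h1 := hA' x
    have h2 := hB' x
    have h3 := hZ' x
    have h4 : x = z → x ∉ T := fun h => h ▸ hz
    simp only [Finset.mem_inter, Finset.mem_insert, Finset.mem_union, Finset.mem_singleton]
    tauto
  have h2 : (insert c (A ∪ B ∪ Z) \ insert z T).card =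
      B.card + (if c ∈ insert z T then 0 else 1) := by
    have := key (insert z T)ᶜ B hcB ?_
    · rw [← Finset.sdiff_eq_inter_compl] at this
      rw [this]
      simp only [Finset.mem_compl, ite_not]
    ext x
    have h1 := hA' x
    have h2 := hB' x
    have h3 := hZ' x
    simp only [Finset.mem_inter, Finset.mem_insert, Finset.mem_union, Finset.mem_singleton,
      Finset.mem_compl]
    tauto
  have h3 : (insert c (A ∪ B ∪ Z) ∩ {z}).card = Z.card + (if c = z then 1 else 0) := by
    have := key {z} Z hcZ ?_
    · simpa using this
    ext x
    have h1 := hA' x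
    have h2 := hB' x
    have h3 := hZ' x
    have h4 : x = z → x ∉ T := fun h => h ▸ hz
    simp only [Finset.mem_inter, Finset.mem_insert, Finset.mem_union, Finset.mem_singleton]
    tauto
  refine ⟨insert c (A ∪ B ∪ Z), Finset.mem_insert_self _ _, ?_, ?_, h1, h2, h3⟩
  · refine Finset.Subset.antisymm (fun x hx => ?_) (by simp [hc])
    simp only [Finset.mem_inter, Finset.mem_insert, Finset.mem_union] at hx
    obtain ⟨hxE, rfl | (hx | hx) | hx⟩ := hx
    · exact Finset.mem_singleton_self _
    · exact absurd hxE (hA' x hx).2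
    · exact absurd hxE (hB' x hx).2
    · exact absurd hxE (hZ' x hx).2
  -- The color `c` is counted in exactly one of the three classes.
  · have h5 : (if c ∈ T then 1 else 0) + (if c ∈ insert z T then 0 else 1) +
        (if c = z then 1 else 0) = 1 := by
      by_cases hT : c ∈ T
      · have hcz : c ≠ z := fun h => hz (h ▸ hT)
        simp [hT, hcz]
      · by_cases hcz : c = z <;> simp [hT, hcz, hz]
    rw [← card_eq_add_add hz, h1, h2, h3]
    omega

theorem exists_next_of_hasNextVia (hz : z ∉ T) {E : Finset C} {c : C} (hc : c ∈ E) {d : ℕ}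
    {P : ℕ → ℕ → ℕ → Kind → Prop}
    (h : HasNextVia T.card ((insert z T)ᶜ).card d P (E ∩ T).card (E \ insert z T).card
      (E ∩ {z}).card (kindOf T z c)) :
    ∃ E' : Finset C, c ∈ E' ∧ E ∩ E' = {c} ∧ E'.card = d ∧ OnCounts T z P E' c := by
  unfold OnCounts
  by_cases hT : c ∈ T
  · have hcz : c ≠ z := fun h => hz (h ▸ hT)
    have hk : kindOf T z c = .target := by simp [kindOf, hT]
    rw [hk] at h ⊢
    obtain ⟨a, b, e, ha, hb, he, rfl, hP⟩ := h
    obtain ⟨E', h1, h2, h3, h4, h5, h6⟩ := exists_next_set hz hc ha hb he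
    refine ⟨E', h1, h2, h3, ?_⟩
    simpa [h4, h5, h6, hT, hcz] using hP
  · by_cases hcz : c = z
    · have hk : kindOf T z c = .last := by simp [kindOf, hcz, hz]
      rw [hk] at h ⊢
      obtain ⟨a, b, e, ha, hb, he, rfl, hP⟩ := h
      obtain ⟨E', h1, h2, h3, h4, h5, h6⟩ := exists_next_set hz hc ha hb he
      refine ⟨E', h1, h2, h3, ?_⟩
      simpa [h4, h5, h6, hcz, hz] using hP
    · have hk : kindOf T z c = .other := by simp [kindOf, hcz, hT]
      rw [hk] at h ⊢
      obtain ⟨a, b, e, ha, hb, he, rfl, hP⟩ := h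
      obtain ⟨E', h1, h2, h3, h4, h5, h6⟩ := exists_next_set hz hc ha hb he
      refine ⟨E', h1, h2, h3, ?_⟩
      simpa [h4, h5, h6, hcz, hT] using hP

end

section
variable {C : Type*} [DecidableEq C] {T : Finset C} {z : C}

/-- The exit color must differ from the entry color `h`, so its kind must offer two colors if `h`
has that kind, and one otherwise. -/
theorem exists_exit {E : Finset C} {h : C} {τ ν d : ℕ} {P : ℕ → ℕ → ℕ → Kind → Prop} (hz : z ∉ T)
    (H : HasNext τ ν d P (E ∩ T).card (E \ insert z T).card (E ∩ {z}).card (kindOf T z h)) :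
    ∃ c ∈ E, c ≠ h ∧ HasNextVia τ ν d P (E ∩ T).card (E \ insert z T).card (E ∩ {z}).card
      (kindOf T z c) := by
  have aux : ∀ (S : Finset C) (κ : Kind), (∀ c ∈ S, kindOf T z c = κ) → 1 ≤ S.card →
      (kindOf T z h = κ → 2 ≤ S.card) → ∃ c ∈ S, c ≠ h := by
    intro S κ hS h1 h2
    by_cases hκ : kindOf T z h = κ
    · exact Finset.exists_mem_ne (h2 hκ) h
    · obtain ⟨c, hc⟩ := Finset.card_pos.1 h1
      exact ⟨c, hc, fun hch => hκ (hch ▸ hS c hc)⟩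
  have hkT : ∀ c ∈ E ∩ T, kindOf T z c = .target := by
    intro c hc
    simp [kindOf, (Finset.mem_inter.1 hc).2]
  have hkN : ∀ c ∈ E \ insert z T, kindOf T z c = .other := by
    intro c hc
    simp only [Finset.mem_sdiff, Finset.mem_insert, not_or] at hc
    simp [kindOf, hc.2.1, hc.2.2]
  have hkZ : ∀ c ∈ E ∩ {z}, kindOf T z c = .last := by
    intro c hc
    simp only [Finset.mem_inter, Finset.mem_singleton] at hc
    simp [kindOf, hc.2, hz]
  rcases H with ⟨hc, H⟩ | ⟨hc, H⟩ | ⟨hc, H⟩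
  · obtain ⟨c, hc, hne⟩ := aux _ _ hkT (by revert hc; split <;> omega)
      (fun h => by rw [h] at hc; exact hc)
    refine ⟨c, (Finset.mem_inter.1 hc).1, hne, ?_⟩
    rw [hkT c hc]
    exact H
  · obtain ⟨c, hc, hne⟩ := aux _ _ hkN (by revert hc; split <;> omega)
      (fun h => by rw [h] at hc; exact hc)
    refine ⟨c, (Finset.mem_sdiff.1 hc).1, hne, ?_⟩
    rw [hkN c hc]
    exact H
  · obtain ⟨c, hc, hne⟩ := aux _ _ hkZ (by revert hc; split <;> omega)
      (fun h => by rw [h] at hc; exact hc)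
    refine ⟨c, (Finset.mem_inter.1 hc).1, hne, ?_⟩
    rw [hkZ c hc]
    exact H

theorem one_le_of_kindOf {E : Finset C} {h : C} (hh : h ∈ E) :
    (kindOf T z h = .target → 1 ≤ (E ∩ T).card) ∧
    (kindOf T z h = .other → 1 ≤ (E \ insert z T).card) ∧
    (kindOf T z h = .last → 1 ≤ (E ∩ {z}).card) := by
  simp only [Nat.one_le_iff_ne_zero, Finset.card_ne_zero]
  by_cases hT : h ∈ T
  · simp only [kindOf, hT, if_true]
    exact ⟨fun _ => ⟨h, by simp [hh, hT]⟩, by simp, by simp⟩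
  · by_cases hz : h = z
    · simp only [kindOf, hz, if_true]
      subst hz
      exact ⟨by simp [hT], by simp [hT], fun _ => ⟨h, by simp [hh]⟩⟩
    · simp only [kindOf, hT, hz, if_false]
      exact ⟨by simp, fun _ => ⟨h, by simp [hh, hT, hz]⟩, by simp⟩

/-! ### Color sets along threads and closed threads -/

/-- Color sets along a thread of length `m`: `E i` is the set of colors at the `i`-th vertex and
`c i` is the color of the edge between the vertices `i` and `i + 1`. -/
def IsThreadColoring (m : ℕ) (E : ℕ → Finset C) (c : ℕ → C) : Prop :=
  (∀ i, 1 ≤ i → i ≤ m → c (i - 1) ∈ E i ∧ c i ∈ E i ∧ c (i - 1) ≠ c i) ∧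
    ∀ i ≤ m, E i ∩ E (i + 1) ⊆ {c i}

theorem IsThreadColoring.reverse {m : ℕ} {E : ℕ → Finset C} {c : ℕ → C}
    (h : IsThreadColoring m E c) :
    IsThreadColoring m (fun i => E (m + 1 - i)) (fun i => c (m - i)) := by
  refine ⟨fun i hi him => ?_, fun i hi => ?_⟩
  · obtain ⟨h1, h2, h3⟩ := h.1 (m + 1 - i) (by omega) (by omega)
    have e1 : m - (i - 1) = m + 1 - i := by omega
    have e2 : m + 1 - i - 1 = m - i := by omega
    simp only [e1]
    rw [e2] at h1 h3
    exact ⟨h2, h1, h3.symm⟩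
  · have := h.2 (m - i) (by omega)
    have e1 : m - i + 1 = m + 1 - i := by omega
    have e2 : m + 1 - (i + 1) = m - i := by omega
    rw [e1, Finset.inter_comm] at this
    simpa only [e2] using this

theorem card_inter_singleton_le (E : Finset C) : (E ∩ {z}).card ≤ 1 :=
  (Finset.card_le_card Finset.inter_subset_right).trans (Finset.card_singleton z).le

variable [Fintype C]

theorem card_compl_insert (hz : z ∉ T) : T.card + ((insert z T)ᶜ).card + 1 = Fintype.card C := by
  have := Finset.card_add_card_compl (insert z T)
  rw [Finset.card_insert_of_notMem hz] at this
  omega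

theorem card_sdiff_insert_le (E : Finset C) :
    (E \ insert z T).card ≤ ((insert z T)ᶜ).card :=
  Finset.card_le_card fun x hx => by
    simp only [Finset.mem_sdiff] at hx
    simpa using hx.2

/-- The game is played to its end. The bound on `d k` makes room for the final set outside the
targets; it is not needed for `k = 0`, where that set is already given. -/
theorem exists_sets_of_winning (hz : z ∉ T) (hτ : 2 ≤ T.card) (hν : 2 ≤ ((insert z T)ᶜ).card)
    (k : ℕ) : ∀ (d : ℕ → ℕ) (E : Finset C) (h : C), E.card = d 0 → h ∈ E →
      (∀ i ≤ k, 3 ≤ d i ∧ d i + 2 ≤ Fintype.card C) →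
      (∀ i < k, d i + d (i + 1) ≤ Fintype.card C + 1) →
      (1 ≤ k → d k + T.card ≤ Fintype.card C) →
      OnCounts T z (Winning T.card ((insert z T)ᶜ).card k) E h →
      ∃ (Es : ℕ → Finset C) (cs : ℕ → C), Es 0 = E ∧ cs 0 = h ∧ cs (k + 1) = z ∧
        (∀ i ≤ k, (Es i).card = d i ∧ cs i ∈ Es i ∧ cs (i + 1) ∈ Es i ∧ cs i ≠ cs (i + 1)) ∧
        (∀ i < k, Es i ∩ Es (i + 1) = {cs (i + 1)}) ∧ Disjoint (Es k) T := by
  have hcard := card_compl_insert hz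
  induction k with
  | zero =>
    intro d E h hE hh _ _ _ hW
    have hW' : (E ∩ T).card = 0 ∧ (E ∩ {z}).card = 1 ∧ h ≠ z := by
      unfold OnCounts at hW
      by_cases hhz : h = z
      · have : kindOf T z h = .last := by simp [kindOf, hhz, hz]
        rw [this] at hW
        exact hW.elim
      · cases hk : kindOf T z h <;> rw [hk] at hW
        · exact ⟨hW.1, hW.2, hhz⟩
        · exact ⟨hW.1, hW.2, hhz⟩
        · exact hW.elim
    obtain ⟨h1, h2, h3⟩ := hW'
    have hzE : z ∈ E := by
      by_contra hzE
      rw [Finset.inter_singleton_of_notMem hzE] at h2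
      simp at h2
    refine ⟨fun _ => E, fun i => if i = 0 then h else z, rfl, rfl, rfl, ?_, by simp, ?_⟩
    · intro i hi
      obtain rfl : i = 0 := by omega
      exact ⟨hE, by simpa using hh, by simpa using hzE, by simpa using h3⟩
    · rw [Finset.disjoint_iff_inter_eq_empty]
      exact Finset.card_eq_zero.1 h1
  | succ k ih =>
    intro d E h hE hh hd hdd hdT hW
    have hsum := card_eq_add_add hz E
    obtain ⟨hk1, hk2, hk3⟩ := one_le_of_kindOf (T := T) (z := z) hh
    have hd0 := hd 0 (by omega)
    have hd1 := hd 1 (by omega)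
    have hd01 := hdd 0 (by omega)
    rw [zero_add] at hd01
    have hstep := winning_step (d := d 1) k hν hτ hd1.1 (by omega) (by omega) (by omega)
      (Finset.card_le_card Finset.inter_subset_right) (card_sdiff_insert_le E)
      (card_inter_singleton_le E) hk1 hk2 hk3 (by
        rintro rfl
        have := hdT (by omega)
        simp only [zero_add] at this
        omega) hW
    obtain ⟨c, hc, hch, hvia⟩ := exists_exit hz hstep
    obtain ⟨E', hcE', hEE', hE', hW'⟩ := exists_next_of_hasNextVia hz hc hvia
    obtain ⟨Es, cs, hEs0, hcs0, hcsk, h1, h2, h3⟩ := ih (fun i => d (i + 1)) E' c hE' hcE'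
      (fun i hi => hd (i + 1) (by omega)) (fun i hi => hdd (i + 1) (by omega))
      (fun _ => hdT (by omega)) hW'
    refine ⟨fun i => Nat.casesOn i E Es, fun i => Nat.casesOn i h cs, rfl, rfl, hcsk, ?_, ?_, h3⟩
    · rintro (_ | i) hi
      · exact ⟨hE, hh, by simpa [hcs0] using hc, by simpa [hcs0] using hch.symm⟩
      · exact h1 i (by omega)
    · rintro (_ | i) hi
      · simpa [hEs0, hcs0] using hEE'
      · exact h2 i (by omega)

end

section
variable {C : Type*} [DecidableEq C] [Fintype C]

/-- The targets are the colors of `B` other than `b`: a final set avoiding them meets `B` in `b` at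
most. -/
theorem exists_threadColoring_of_hasNextVia {m : ℕ} {d : ℕ → ℕ} {A B : Finset C} {a b : C}
    (hb : b ∈ B) (hd : ∀ i ≤ m + 2, 3 ≤ d i ∧ d i + 2 ≤ Fintype.card C)
    (hdd : ∀ i ≤ m + 1, d i + d (i + 1) ≤ Fintype.card C + 1)
    (hBd : B.card = d (m + 2)) (ha : a ∈ A)
    (hnext : HasNextVia (B.erase b).card ((insert b (B.erase b))ᶜ).card (d 1)
      (Winning (B.erase b).card ((insert b (B.erase b))ᶜ).card m) (A ∩ B.erase b).card
      (A \ insert b (B.erase b)).card (A ∩ {b}).card (kindOf (B.erase b) b a)) :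
    ∃ (E : ℕ → Finset C) (c : ℕ → C), E 0 = A ∧ E (m + 2) = B ∧ c 0 = a ∧ c (m + 1) = b ∧
      (∀ i, 1 ≤ i → i ≤ m + 1 → (E i).card = d i) ∧ IsThreadColoring (m + 1) E c := by
  have hz : b ∉ B.erase b := Finset.notMem_erase b B
  have hT : (B.erase b).card + 1 = B.card := Finset.card_erase_add_one hb
  have hcard := card_compl_insert hz
  have hdm := hd (m + 2) le_rfl
  obtain ⟨E', haE', hAE', hE', hW⟩ := exists_next_of_hasNextVia hz ha hnext
  obtain ⟨Es, cs, hEs0, hcs0, hcsk, h1, h2, h3⟩ := exists_sets_of_winning hz (by omega) (by omega) m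
    (fun i => d (i + 1)) E' a hE' haE' (fun i hi => hd (i + 1) (by omega))
    (fun i hi => hdd (i + 1) (by omega))
    (fun _ => by have := hdd (m + 1) le_rfl; simp only [add_assoc, Nat.reduceAdd] at this; omega) hW
  have hEi : ∀ i, 1 ≤ i → i ≤ m + 1 →
      (if i = 0 then A else if i = m + 2 then B else Es (i - 1)) = Es (i - 1) := by
    intro i hi him
    rw [if_neg (by omega), if_neg (by omega)]
  refine ⟨fun i => if i = 0 then A else if i = m + 2 then B else Es (i - 1), cs, by simp, by simp,
    hcs0, hcsk, fun i hi him => ?_, fun i hi him => ?_, fun i hi => ?_⟩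
  · simp only [hEi i hi him]
    have := (h1 (i - 1) (by omega)).1
    rwa [Nat.sub_add_cancel hi] at this
  · simp only [hEi i hi him]
    have := (h1 (i - 1) (by omega)).2
    rwa [Nat.sub_add_cancel hi] at this
  · obtain rfl | hi0 := Nat.eq_zero_or_pos i
    · simp [hEs0, hcs0, hAE']
    · simp only [hEi i hi0 hi]
      obtain rfl | him := Nat.eq_or_lt_of_le hi
      · simp only [add_tsub_cancel_right, Nat.add_eq_zero_iff, one_ne_zero, and_false, if_false,
          if_true, hcsk]
        intro x hx
        rw [Finset.mem_inter] at hx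
        by_contra hxb
        rw [Finset.mem_singleton] at hxb
        exact Finset.disjoint_left.1 h3 hx.1 (Finset.mem_erase.2 ⟨hxb, hx.2⟩)
      · rw [if_neg (by omega), if_neg (by omega), add_tsub_cancel_right]
        have := h2 (i - 1) (by omega)
        rw [Nat.sub_add_cancel hi0] at this
        exact this.subset

theorem exists_threadColoring_of_card_le {d : ℕ → ℕ} {A B : Finset C} {a b : C}
    (hC : 5 ≤ Fintype.card C) (ha : a ∈ A) (hb : b ∈ B)
    (hd : ∀ i ≤ ell (Fintype.card C) + 1, 3 ≤ d i ∧ d i + 2 ≤ Fintype.card C)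
    (hdd : ∀ i ≤ ell (Fintype.card C), d i + d (i + 1) ≤ Fintype.card C + 1)
    (hAd : A.card = d 0) (hBd : B.card = d (ell (Fintype.card C) + 1)) (hAB : A.card ≤ B.card) :
    ∃ (E : ℕ → Finset C) (c : ℕ → C), E 0 = A ∧ E (ell (Fintype.card C) + 1) = B ∧ c 0 = a ∧
      c (ell (Fintype.card C)) = b ∧
      (∀ i, 1 ≤ i → i ≤ ell (Fintype.card C) → (E i).card = d i) ∧
      IsThreadColoring (ell (Fintype.card C)) E c := by
  have hell : 1 ≤ ell (Fintype.card C) := by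
    unfold ell; split_ifs <;> omega
  obtain ⟨m, hm⟩ : ∃ m, ell (Fintype.card C) = m + 1 := ⟨_, (Nat.sub_add_cancel hell).symm⟩
  have hz : b ∉ B.erase b := Finset.notMem_erase b B
  have hT : (B.erase b).card + 1 = B.card := Finset.card_erase_add_one hb
  have hcard := card_compl_insert hz
  have hsum := card_eq_add_add hz A
  obtain ⟨hk1, hk2, hk3⟩ := one_le_of_kindOf (T := B.erase b) (z := b) ha
  have hd0 := hd 0 (by omega)
  have hd1 := hd 1 (by omega)
  have hdl := hd _ le_rfl
  have hd01 := hdd 0 (by omega)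
  rw [zero_add] at hd01
  have hnext := hasNextVia_winning_ell (τ := (B.erase b).card) (d := d 1)
    (ν := ((insert b (B.erase b))ᶜ).card) (by omega) (by omega) hd1.1 (by omega) (by omega)
    (by omega) (by omega) (Finset.card_le_card Finset.inter_subset_right) (card_sdiff_insert_le A)
    (card_inter_singleton_le A) hk1 hk2 hk3
  rw [hcard, hm, add_tsub_cancel_right] at hnext
  rw [hm] at hd hdd hBd ⊢
  exact exists_threadColoring_of_hasNextVia hb hd hdd hBd ha hnext

/-- Reversing the thread allows assuming that the first end set is not larger than the second. -/
theorem exists_threadColoring {d : ℕ → ℕ} {A B : Finset C} {a b : C}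
    (hC : 5 ≤ Fintype.card C) (ha : a ∈ A) (hb : b ∈ B)
    (hd : ∀ i ≤ ell (Fintype.card C) + 1, 3 ≤ d i ∧ d i + 2 ≤ Fintype.card C)
    (hdd : ∀ i ≤ ell (Fintype.card C), d i + d (i + 1) ≤ Fintype.card C + 1)
    (hAd : A.card = d 0) (hBd : B.card = d (ell (Fintype.card C) + 1)) :
    ∃ (E : ℕ → Finset C) (c : ℕ → C), E 0 = A ∧ E (ell (Fintype.card C) + 1) = B ∧ c 0 = a ∧
      c (ell (Fintype.card C)) = b ∧
      (∀ i, 1 ≤ i → i ≤ ell (Fintype.card C) → (E i).card = d i) ∧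
      IsThreadColoring (ell (Fintype.card C)) E c := by
  obtain hAB | hAB := le_total A.card B.card
  · exact exists_threadColoring_of_card_le hC ha hb hd hdd hAd hBd hAB
  · set l := ell (Fintype.card C) with hl
    obtain ⟨E, c, h0, h1, h2, h3, h4, h5⟩ :=
      exists_threadColoring_of_card_le (d := fun i => d (l + 1 - i)) hC hb ha
        (fun i hi => hd _ (by omega))
        (fun i hi => by
          have := hdd (l - i) (by omega)
          rw [show l - i + 1 = l + 1 - i by omega, show l - i = l + 1 - (i + 1) by omega] at this
          omega)
        hBd (by rw [hAd]; simp [← hl]) hAB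
    rw [← hl] at h1 h3 h4 h5
    refine ⟨_, _, by simpa using h1, by simpa using h0, by simpa using h3, by simpa using h2,
      fun i hi hil => ?_, h5.reverse⟩
    rw [h4 _ (by omega) (by omega)]
    congr 1
    omega

/-- Both ends carry `A`. The first step is played as if `A` had been entered through `b`. -/
theorem exists_closed_threadColoring {n : ℕ} {d : ℕ → ℕ} {A : Finset C} {a b : C}
    (ha : a ∈ A) (hb : b ∈ A) (hab : a ≠ b)
    (hn : (Even n ∧ 6 ≤ n) ∨ (Odd n ∧ 7 ≤ n ∧ Fintype.card C ≤ n)) (hn7 : n = 7 → 4 ≤ d 0)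
    (hd : ∀ i ≤ n, 3 ≤ d i ∧ d i + 2 ≤ Fintype.card C)
    (hdd : ∀ i < n, d i + d (i + 1) ≤ Fintype.card C + 1)
    (hAd : A.card = d 0) (hAdn : A.card = d n) :
    ∃ (E : ℕ → Finset C) (c : ℕ → C), E 0 = A ∧ E n = A ∧ c 0 = a ∧ c (n - 1) = b ∧
      (∀ i, 1 ≤ i → i < n → (E i).card = d i) ∧ IsThreadColoring (n - 1) E c := by
  obtain ⟨m, rfl⟩ : ∃ m, n = m + 2 := ⟨n - 2, by omega⟩
  have hz : b ∉ A.erase b := Finset.notMem_erase b A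
  have hT : (A.erase b).card + 1 = A.card := Finset.card_erase_add_one hb
  have hcard := card_compl_insert hz
  have hd0 := hd 0 (by omega)
  have hd1 := hd 1 (by omega)
  have hd01 := hdd 0 (by omega)
  rw [zero_add] at hd01
  obtain ⟨hk1, hk2, hk3⟩ := one_le_of_kindOf (T := A.erase b) (z := b) hb
  have hsum := card_eq_add_add hz A
  have hAT : A ∩ A.erase b = A.erase b := Finset.inter_eq_right.2 (Finset.erase_subset b A)
  have hAz : A ∩ {b} = {b} := Finset.inter_singleton_of_mem hb
  have hW := winning_closed (τ := (A.erase b).card) (ν := ((insert b (A.erase b))ᶜ).card)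
    (n := m + 2) (by rwa [hcard]) (fun h => by have := hn7 h; omega)
  have hk : kindOf (A.erase b) b b = .last := by simp [kindOf]
  have hAN : (A \ insert b (A.erase b)).card = 0 := by
    rw [Finset.insert_erase hb, Finset.sdiff_self, Finset.card_empty]
  have hstep := winning_step (d := d 1) m (h := kindOf (A.erase b) b b) (p := (A ∩ A.erase b).card)
    (q := (A \ insert b (A.erase b)).card) (z := (A ∩ {b}).card) (by omega) (by omega) hd1.1
    (by omega) (by omega) (by omega) (Finset.card_le_card Finset.inter_subset_right)
    (card_sdiff_insert_le A) (card_inter_singleton_le A) hk1 hk2 hk3 (by omega)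
    (by rw [hAT, hAN, hAz, Finset.card_singleton, hk]; exact hW)
  obtain ⟨c, hc, hcb, hvia⟩ := exists_exit hz hstep
  -- The exit color found and the prescribed `a` are both targets, and only the kind matters.
  have hkc : kindOf (A.erase b) b c = kindOf (A.erase b) b a := by
    simp [kindOf, hc, hcb, ha, hab]
  rw [hkc] at hvia
  obtain ⟨E, c, h0, h1, h2, h3, h4, h5⟩ := exists_threadColoring_of_hasNextVia hb hd
    (fun i hi => hdd i (by omega)) hAdn ha hvia
  exact ⟨E, c, h0, h1, h2, h3, fun i hi him => h4 i hi (by omega), h5⟩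

end

open SimpleGraph

/-! ### Local colorings and their extension -/

section
variable {V C : Type*}

/-- A coloring of the ordered adjacent pairs which is, seen locally, a strong edge-coloring. -/
structure IsLocalColoring (G : SimpleGraph V) (c : V → V → C) : Prop where
  symm : ∀ x y, G.Adj x y → c x y = c y x
  inj : ∀ x u v, G.Adj x u → G.Adj x v → c x u = c x v → u = v
  edge : ∀ x y u v, G.Adj x y → G.Adj x u → G.Adj y v → c x u = c y v → u = y ∧ v = x

/-- The degree of a vertex, without decidability assumptions. -/
noncomputable def deg (G : SimpleGraph V) (v : V) : ℕ := (G.neighborSet v).ncard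

theorem deg_mono [Finite V] {G H : SimpleGraph V} (h : H ≤ G) (v : V) : deg H v ≤ deg G v :=
  Set.ncard_le_ncard (fun _ hu => h hu) (Set.toFinite _)

theorem eq_of_deg_le_one [Finite V] {G : SimpleGraph V} {v a b : V} (h : deg G v ≤ 1)
    (ha : G.Adj v a) (hb : G.Adj v b) : a = b :=
  (Set.ncard_le_one (Set.toFinite _)).1 h a ha b hb

/-- The graph `G` without the edges inside `P` and without the pendant edges at `P`. -/
def removePendant (G : SimpleGraph V) (P : Set V) : SimpleGraph V where
  Adj x y := G.Adj x y ∧ ¬ (x ∈ P ∧ (y ∈ P ∨ deg G y ≤ 1)) ∧ ¬ (y ∈ P ∧ (x ∈ P ∨ deg G x ≤ 1))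
  symm := ⟨fun _ _ h => ⟨h.1.symm, h.2.2, h.2.1⟩⟩
  loopless := ⟨fun _ h => h.1.ne rfl⟩

theorem removePendant_le (G : SimpleGraph V) (P : Set V) : removePendant G P ≤ G :=
  fun _ _ h => h.1

theorem removePendant_adj {G : SimpleGraph V} {P : Set V} {x y : V} (hx : x ∉ P) (h : G.Adj x y)
    (hxy : y ∈ P → 2 ≤ deg G x) : (removePendant G P).Adj x y :=
  ⟨h, fun h' => hx h'.1, fun h' => h'.2.elim hx fun h1 => by have := hxy h'.1; omega⟩

-- `F` colors all edges at `P`. Edges from `P` to outside vertices of degree at least two are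
-- already colored, and there `F` has to agree with `c`; a pendant edge is read from its end in `P`.
-- All conditions concern the edges at the two ends of a single edge, so checking edges that meet
-- `P` suffices.
open Classical in
theorem IsLocalColoring.extend [Finite V] {G : SimpleGraph V} {P : Set V} {c F : V → V → C}
    (hc : IsLocalColoring (removePendant G P) c)
    (h0 : ∀ x ∈ P, 2 ≤ deg G x)
    (h1 : ∀ x ∈ P, ∀ u v, G.Adj x u → G.Adj x v → F x u = F x v → u = v)
    (h2 : ∀ x ∈ P, ∀ y ∈ P, G.Adj x y → F x y = F y x ∧
      ∀ u v, G.Adj x u → G.Adj y v → F x u = F y v → u = y ∧ v = x)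
    (h3 : ∀ x ∈ P, ∀ y ∉ P, 2 ≤ deg G y → G.Adj x y → F x y = c y x ∧
      ∀ u v, G.Adj x u → G.Adj y v → F x u = c y v → u = y ∧ v = x) :
    ∃ c' : V → V → C, IsLocalColoring G c' := by
  set c' : V → V → C := fun a b =>
    if a ∈ P then F a b else if b ∈ P ∧ deg G a ≤ 1 then F b a else c a b with hc'
  have e1 : ∀ a ∈ P, ∀ b, c' a b = F a b := fun a ha b => by simp [hc', ha]
  have e2 : ∀ a b, b ∈ P → deg G a ≤ 1 → c' a b = F b a := fun a b hb ha => by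
    have : a ∉ P := fun h => by have := h0 a h; omega
    simp [hc', this, hb, ha]
  have e3 : ∀ a ∉ P, ∀ b, (b ∈ P → 2 ≤ deg G a) → c' a b = c a b := fun a ha b hb => by
    have : ¬ (b ∈ P ∧ deg G a ≤ 1) := fun h => by have := hb h.1; omega
    simp only [hc', if_neg ha, if_neg this]
  have key : ∀ x ∈ P, ∀ y u v, G.Adj x y → G.Adj x u → G.Adj y v → c' x u = c' y v →
      u = y ∧ v = x := by
    intro x hx y u v hxy hxu hyv h
    rw [e1 x hx] at h
    by_cases hy : y ∈ P
    · rw [e1 y hy] at h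
      exact (h2 x hx y hy hxy).2 u v hxu hyv h
    · by_cases hyd : deg G y ≤ 1
      · obtain rfl := eq_of_deg_le_one hyd hyv hxy.symm
        rw [e2 y v hx hyd] at h
        exact ⟨h1 v hx u y hxu hxy h, rfl⟩
      · rw [e3 y hy v (fun _ => by omega)] at h
        exact (h3 x hx y hy (by omega) hxy).2 u v hxu hyv h
  -- A vertex outside `P` with neighbors both inside and outside `P` is no leaf, so its edges into
  -- `P` survive in the reduced graph.
  have key2 : ∀ x ∉ P, ∀ u y, G.Adj x u → G.Adj x y → y ∉ P → (u ∈ P → 2 ≤ deg G x) := by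
    intro x hx u y hxu hxy hy hu
    by_contra hd
    exact hy (eq_of_deg_le_one (by omega) hxu hxy ▸ hu)
  refine ⟨c', fun x y h => ?_, fun x u v hu hv h => ?_, fun x y u v hxy hxu hyv h => ?_⟩
  · have key : ∀ x ∈ P, ∀ y, G.Adj x y → c' x y = c' y x := by
      intro x hx y h
      rw [e1 x hx]
      by_cases hy : y ∈ P
      · rw [e1 y hy, (h2 x hx y hy h).1]
      · by_cases hyd : deg G y ≤ 1
        · rw [e2 y x hx hyd]
        · rw [e3 y hy x (fun _ => by omega), (h3 x hx y hy (by omega) h).1]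
    by_cases hx : x ∈ P
    · exact key x hx y h
    by_cases hy : y ∈ P
    · exact (key y hy x h.symm).symm
    rw [e3 x hx y (fun h => absurd h hy), e3 y hy x (fun h => absurd h hx)]
    exact hc.symm x y (removePendant_adj hx h (fun h => absurd h hy))
  · by_cases hx : x ∈ P
    · rw [e1 x hx, e1 x hx] at h
      exact h1 x hx u v hu hv h
    · by_cases hd : deg G x ≤ 1
      · exact eq_of_deg_le_one hd hu hv
      · rw [e3 x hx u (fun _ => by omega), e3 x hx v (fun _ => by omega)] at h
        exact hc.inj x u v (removePendant_adj hx hu (fun _ => by omega))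
          (removePendant_adj hx hv (fun _ => by omega)) h
  · by_cases hx : x ∈ P
    · exact key x hx y u v hxy hxu hyv h
    by_cases hy : y ∈ P
    · exact (key y hy x v u hxy.symm hyv hxu h.symm).symm
    have hu := key2 x hx u y hxu hxy hy
    have hv := key2 y hy v x hyv hxy.symm hx
    rw [e3 x hx u hu, e3 y hy v hv] at h
    exact hc.edge x y u v (removePendant_adj hx hxy (fun h => absurd h hy))
      (removePendant_adj hx hxu hu) (removePendant_adj hy hyv hv) h

theorem exists_injOn_extending [Finite V] [DecidableEq C] {A : Set V} {E : Finset C} {a b : V}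
    {α β : C}
    (ha : a ∈ A) (hb : b ∈ A) (hab : a ≠ b) (hα : α ∈ E) (hβ : β ∈ E) (hαβ : α ≠ β)
    (hcard : A.ncard ≤ E.card) :
    ∃ f : V → C, Set.InjOn f A ∧ (∀ v ∈ A, f v ∈ E) ∧ f a = α ∧ f b = β := by
  classical
  have hA : ((A \ {a}) \ {b}).ncard + 2 = A.ncard := by
    have h1 := Set.ncard_sdiff_singleton_add_one (s := A) ha (Set.toFinite _)
    have h2 := Set.ncard_sdiff_singleton_add_one (s := A \ {a}) (a := b) ⟨hb, fun h => hab h.symm⟩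
      (Set.toFinite _)
    omega
  have hE : ((E.erase α).erase β).card + 2 = E.card := by
    have h1 := Finset.card_erase_add_one hα
    have h2 := Finset.card_erase_add_one (Finset.mem_erase.2 ⟨hαβ.symm, hβ⟩)
    omega
  have : Nonempty C := ⟨α⟩
  obtain ⟨g, hg1, hg2⟩ := Set.Finite.exists_injOn_of_encard_le (s := (A \ {a}) \ {b})
      (t := (((E.erase α).erase β : Finset C) : Set C)) (Set.toFinite _) (by
    rw [← Set.Finite.cast_ncard_eq (Set.toFinite _), Set.encard_coe_eq_coe_finsetCard]
    exact_mod_cast (by omega))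
  have hg : ∀ v ∈ A, v ≠ a → v ≠ b → g v ≠ β ∧ g v ≠ α ∧ g v ∈ E := by
    intro v hv hva hvb
    have := hg1 (show v ∈ (A \ {a}) \ {b} from ⟨⟨hv, hva⟩, hvb⟩)
    simp at this
    tauto
  have f1 : ∀ v, v ≠ a → v ≠ b → (if v = a then α else if v = b then β else g v) = g v :=
    fun v h1 h2 => by rw [if_neg h1, if_neg h2]
  refine ⟨fun v => if v = a then α else if v = b then β else g v, ?_, ?_, by simp,
    by simp [hab.symm]⟩
  · intro u hu v hv h
    simp only at h
    by_cases hua : u = a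
    · subst hua
      by_cases hva : v = u
      · exact hva.symm
      by_cases hvb : v = b
      · subst hvb
        simp [hva, hαβ] at h
      · rw [f1 v hva hvb, if_pos rfl] at h
        exact absurd h.symm (hg v hv hva hvb).2.1
    by_cases hub : u = b
    · subst hub
      by_cases hva : v = a
      · subst hva
        simp [hua, hαβ.symm] at h
      by_cases hvb : v = u
      · exact hvb.symm
      · rw [f1 v hva hvb, if_neg hua, if_pos rfl] at h
        exact absurd h.symm (hg v hv hva hvb).1
    rw [f1 u hua hub] at h
    by_cases hva : v = a
    · rw [if_pos hva] at h
      exact absurd h (hg u hu hua hub).2.1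
    by_cases hvb : v = b
    · rw [if_neg hva, if_pos hvb] at h
      exact absurd h (hg u hu hua hub).1
    rw [f1 v hva hvb] at h
    exact hg2 ⟨⟨hu, hua⟩, hub⟩ ⟨⟨hv, hva⟩, hvb⟩ h
  · intro v hv
    simp only
    split_ifs with h1 h2
    · exact hα
    · exact hβ
    · exact (hg v hv h1 h2).2.2

/-- A strong edge-coloring of the rest of the graph extends along a thread `x 1, …, x m`, where the
color sets `E 0` and `E (m + 1)` contain the colors at the two ends. -/
theorem IsLocalColoring.extend_thread [Finite V] [DecidableEq C] {G : SimpleGraph V}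
    {m : ℕ} {x : ℕ → V} {c : V → V → C} {E : ℕ → Finset C} {cs : ℕ → C} (hm : 1 ≤ m)
    (hinj : ∀ i j, 1 ≤ i → i ≤ m → j ≤ m + 1 → x i = x j → i = j)
    (hdeg : ∀ i ≤ m + 1, 2 ≤ deg G (x i))
    (hadj : ∀ i ≤ m, G.Adj (x i) (x (i + 1)))
    (hne : ∀ i, 1 ≤ i → i ≤ m → x (i - 1) ≠ x (i + 1))
    (hnb : ∀ i, 1 ≤ i → i ≤ m → ∀ y, G.Adj (x i) y → 2 ≤ deg G y → y = x (i - 1) ∨ y = x (i + 1))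
    (hc : IsLocalColoring (removePendant G {v | ∃ i, 1 ≤ i ∧ i ≤ m ∧ x i = v}) c)
    (hE : IsThreadColoring m E cs)
    (hcard : ∀ i, 1 ≤ i → i ≤ m → deg G (x i) ≤ (E i).card)
    (hE0 : ∀ u, G.Adj (x 0) u → c (x 0) u ∈ E 0)
    (hEm : ∀ u, G.Adj (x (m + 1)) u → c (x (m + 1)) u ∈ E (m + 1))
    (hc0 : cs 0 = c (x 0) (x 1)) (hcm : cs m = c (x (m + 1)) (x m)) :
    ∃ c' : V → V → C, IsLocalColoring G c' := by
  set P : Set V := {v | ∃ i, 1 ≤ i ∧ i ≤ m ∧ x i = v} with hP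
  -- At each thread vertex the edges are colored injectively from `E i`, with the two thread edges
  -- receiving their prescribed colors; only an inequality of cardinalities is needed.
  have hf : ∀ i, ∃ f : V → C, 1 ≤ i → i ≤ m → Set.InjOn f (G.neighborSet (x i)) ∧
      (∀ v, G.Adj (x i) v → f v ∈ E i) ∧ f (x (i - 1)) = cs (i - 1) ∧ f (x (i + 1)) = cs i := by
    intro i
    by_cases hi : 1 ≤ i ∧ i ≤ m
    · obtain ⟨h1, h2, h3⟩ := hE.1 i hi.1 hi.2
      have ha := hadj (i - 1) (by omega)
      rw [Nat.sub_add_cancel hi.1] at ha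
      obtain ⟨f, hf⟩ := exists_injOn_extending (A := G.neighborSet (x i)) ha.symm (hadj i hi.2)
        (hne i hi.1 hi.2) h1 h2 h3 (hcard i hi.1 hi.2)
      exact ⟨f, fun _ _ => hf⟩
    · exact ⟨fun _ => cs 0, fun h1 h2 => absurd ⟨h1, h2⟩ hi⟩
  choose f hf using hf
  have hidx : ∀ v, ∃ i, v ∈ P → 1 ≤ i ∧ i ≤ m ∧ x i = v := by
    intro v
    by_cases hv : v ∈ P
    · obtain ⟨i, hi⟩ := hv
      exact ⟨i, fun _ => hi⟩
    · exact ⟨0, fun h => absurd h hv⟩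
  choose idx hidx using hidx
  have hidx' : ∀ i, 1 ≤ i → i ≤ m → idx (x i) = i := by
    intro i hi him
    obtain ⟨h1, h2, h3⟩ := hidx (x i) ⟨i, hi, him, rfl⟩
    exact hinj _ _ h1 h2 (by omega) h3
  have hxP : ∀ i, 1 ≤ i → i ≤ m → x i ∈ P := fun i h1 h2 => ⟨i, h1, h2, rfl⟩
  -- Neighboring sets share only the color of the thread edge, so injectivity identifies both edges
  -- with it.
  have inner : ∀ i, 1 ≤ i → i + 1 ≤ m → ∀ u v, G.Adj (x i) u → G.Adj (x (i + 1)) v →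
      f i u = f (i + 1) v → u = x (i + 1) ∧ v = x i := by
    intro i hi him u v hu hv h
    obtain ⟨i1, i2, i3, i4⟩ := hf i hi (by omega)
    obtain ⟨j1, j2, j3, j4⟩ := hf (i + 1) (by omega) him
    rw [Nat.add_sub_cancel] at j3
    have hmem : f i u ∈ E i ∩ E (i + 1) :=
      Finset.mem_inter.2 ⟨i2 u hu, h ▸ j2 v hv⟩
    have hfu := Finset.mem_singleton.1 (hE.2 i (by omega) hmem)
    refine ⟨i1 hu (hadj i (by omega)) (hfu.trans i4.symm), ?_⟩
    exact j1 hv (hadj i (by omega)).symm ((h.symm.trans hfu).trans j3.symm)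
  refine hc.extend (F := fun v => f (idx v)) ?_ ?_ ?_ ?_
  · rintro _ ⟨i, hi, him, rfl⟩
    exact hdeg i (by omega)
  · rintro _ ⟨i, hi, him, rfl⟩ u v hu hv h
    simp only [hidx' i hi him] at h
    exact (hf i hi him).1 hu hv h
  · rintro _ ⟨i, hi, him, rfl⟩ _ ⟨j, hj, hjm, rfl⟩ hij
    simp only [hidx' i hi him, hidx' j hj hjm]
    rcases hnb i hi him _ hij (hdeg j (by omega)) with h | h
    · have hji := hinj j _ hj hjm (by omega) h
      obtain rfl : i = j + 1 := by omega
      refine ⟨?_, fun u v hu hv h => (inner j hj him v u hv hu h.symm).symm⟩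
      have h1 := (hf j hj hjm).2.2.2
      have h2 := (hf (j + 1) hi him).2.2.1
      rw [Nat.add_sub_cancel] at h2
      rw [h1, h2]
    · obtain rfl := hinj j _ hj hjm (by omega) h
      refine ⟨?_, inner i hi hjm⟩
      have h1 := (hf i hi him).2.2.2
      have h2 := (hf (i + 1) hj hjm).2.2.1
      rw [Nat.add_sub_cancel] at h2
      rw [h1, h2]
  · rintro _ ⟨i, hi, him, rfl⟩ y hy hyd hiy
    simp only [hidx' i hi him]
    obtain ⟨i1, i2, i3, i4⟩ := hf i hi him
    have hyx := hnb i hi him y hiy hyd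
    -- The already colored edges at the thread are exactly those to its two ends.
    have hcase : (i = 1 ∧ y = x 0) ∨ (i = m ∧ y = x (m + 1)) := by
      rcases hyx with rfl | rfl
      · left
        have : i = 1 := by
          by_contra h1
          exact hy (hxP (i - 1) (by omega) (by omega))
        subst this
        exact ⟨rfl, rfl⟩
      · right
        have : i = m := by
          by_contra h1
          exact hy (hxP (i + 1) (by omega) (by omega))
        subst this
        exact ⟨rfl, rfl⟩
    have hfy : ∀ y', f i y = c y' (x i) → y = y' → ∀ u v, G.Adj (x i) u → G.Adj y' v →
        f i u = c y' v → f i u = f i y → u = y ∧ v = x i := by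
      rintro _ h1 rfl u v hu hv h2 h3
      refine ⟨i1 hu hiy h3, ?_⟩
      refine hc.inj y v (x i) (removePendant_adj hy hv fun _ => hyd)
        (removePendant_adj hy hiy.symm fun _ => hyd) ?_
      rw [← h2, ← h1, h3]
    rcases hcase with ⟨rfl, rfl⟩ | ⟨rfl, rfl⟩
    · have h1 : f 1 (x 0) = c (x 0) (x 1) := by rw [← hc0]; exact i3
      refine ⟨h1, fun u v hu hv h => hfy _ h1 rfl u v hu hv h ?_⟩
      have hmem : f 1 u ∈ E 0 ∩ E (0 + 1) := Finset.mem_inter.2 ⟨h ▸ hE0 v hv, i2 u hu⟩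
      rw [Finset.mem_singleton.1 (hE.2 0 (by omega) hmem), hc0, h1]
    · have h1 : f i (x (i + 1)) = c (x (i + 1)) (x i) := by rw [← hcm]; exact i4
      refine ⟨h1, fun u v hu hv h => hfy _ h1 rfl u v hu hv h ?_⟩
      have hmem : f i u ∈ E i ∩ E (i + 1) := Finset.mem_inter.2 ⟨i2 u hu, h ▸ hEm v hv⟩
      rw [Finset.mem_singleton.1 (hE.2 i le_rfl hmem), i4]

open Classical in
/-- A strong edge-coloring extends to a pendant edge at a vertex with at most one neighbor of
degree at least two. -/
theorem IsLocalColoring.extend_leaf [Finite V] [Fintype C] {G : SimpleGraph V} {v w : V}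
    {c : V → V → C} (hvw : G.Adj v w) (hw : deg G w ≤ 1)
    (hv : ∀ u u', G.Adj v u → G.Adj v u' → 2 ≤ deg G u → 2 ≤ deg G u' → u = u')
    (hdd : ∀ u, G.Adj v u → deg G v + deg G u ≤ Fintype.card C + 1)
    (hd : deg G v ≤ Fintype.card C)
    (hc : IsLocalColoring (G.deleteEdges {s(v, w)}) c) :
    ∃ c' : V → V → C, IsLocalColoring G c' := by
  -- The forbidden colors are those of the other edges at `v` and, if there is a non-leaf neighbor
  -- `u`, of the other edges at `u`: at most `deg v + deg u - 2 ≤ σ - 1`.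
  have hγ : ∃ γ : C, ∀ u, G.Adj v u → u ≠ w → c v u ≠ γ ∧ ∀ t, G.Adj u t → t ≠ v → c u t ≠ γ := by
    have hA : (G.neighborSet v \ {w}).ncard + 1 = deg G v :=
      Set.ncard_sdiff_singleton_add_one (s := G.neighborSet v) hvw (Set.toFinite _)
    have hA' : (c v '' (G.neighborSet v \ {w})).ncard ≤ (G.neighborSet v \ {w}).ncard :=
      Set.ncard_image_le (Set.toFinite _)
    by_cases hu : ∃ u, G.Adj v u ∧ 2 ≤ deg G u
    · obtain ⟨u, hvu, hu⟩ := hu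
      have hB : (G.neighborSet u \ {v}).ncard + 1 = deg G u :=
        Set.ncard_sdiff_singleton_add_one (s := G.neighborSet u) hvu.symm (Set.toFinite _)
      have hB' : (c u '' (G.neighborSet u \ {v})).ncard ≤ (G.neighborSet u \ {v}).ncard :=
        Set.ncard_image_le (Set.toFinite _)
      have hdu := hdd u hvu
      have hU := Set.ncard_union_le (c v '' (G.neighborSet v \ {w}))
        (c u '' (G.neighborSet u \ {v}))
      obtain ⟨γ, hγ⟩ : ∃ γ, γ ∉ c v '' (G.neighborSet v \ {w}) ∪ c u '' (G.neighborSet u \ {v}) :=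
          by
        by_contra! hall
        have : (c v '' (G.neighborSet v \ {w}) ∪ c u '' (G.neighborSet u \ {v})) = Set.univ :=
          Set.eq_univ_of_forall hall
        rw [this, Set.ncard_univ, Nat.card_eq_fintype_card] at hU
        omega
      refine ⟨γ, fun y hy hyw => ⟨fun h => hγ (Or.inl ⟨y, ⟨hy, hyw⟩, h⟩), fun t ht htv h => ?_⟩⟩
      have hyd : 2 ≤ deg G y := by
        by_contra hyd
        exact htv (eq_of_deg_le_one (by omega) ht hy.symm)
      obtain rfl := hv y u hy hvu hyd hu
      exact hγ (Or.inr ⟨t, ⟨ht, htv⟩, h⟩)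
    · push Not at hu
      obtain ⟨γ, hγ⟩ : ∃ γ, γ ∉ c v '' (G.neighborSet v \ {w}) := by
        by_contra! hall
        rw [Set.eq_univ_of_forall hall, Set.ncard_univ, Nat.card_eq_fintype_card] at hA'
        omega
      refine ⟨γ, fun y hy hyw => ⟨fun h => hγ ⟨y, ⟨hy, hyw⟩, h⟩, fun t ht htv h => ?_⟩⟩
      exact htv (eq_of_deg_le_one (by have := hu y hy; omega) ht hy.symm)
  obtain ⟨γ, hγ⟩ := hγ
  have hwv : ∀ t, G.Adj w t → t = v := fun t ht => eq_of_deg_le_one hw ht hvw.symm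
  set c' : V → V → C := fun a b => if s(a, b) = s(v, w) then γ else c a b with hc'
  have e1 : ∀ a b, s(a, b) = s(v, w) → c' a b = γ := fun a b h => by simp only [hc', if_pos h]
  have e2 : ∀ a b, s(a, b) ≠ s(v, w) → c' a b = c a b := fun a b h => by simp only [hc', if_neg h]
  have hadj : ∀ a b, G.Adj a b → s(a, b) ≠ s(v, w) → (G.deleteEdges {s(v, w)}).Adj a b :=
    fun a b h h' => by simpa [SimpleGraph.deleteEdges_adj, h] using h'
  have hv' : ∀ u, G.Adj v u → s(v, u) ≠ s(v, w) → c v u ≠ γ := fun u hu h =>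
    (hγ u hu fun h' => h (by rw [h'])).1
  -- an edge of color `γ` close to `v w` is `v w` itself
  have key : ∀ x y u t, G.Adj x y → G.Adj x u → G.Adj y t → s(x, u) = s(v, w) →
      c' x u = c' y t → u = y ∧ t = x := by
    intro x y u t hxy hxu hyt hs h
    rw [e1 x u hs] at h
    by_cases hs' : s(y, t) = s(v, w)
    · rw [← hs', Sym2.eq_iff] at hs
      rcases hs with ⟨rfl, rfl⟩ | ⟨rfl, rfl⟩
      · exact absurd hxy (G.loopless.irrefl _)
      · exact ⟨rfl, rfl⟩
    rw [e2 y t hs'] at h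
    rw [Sym2.eq_iff] at hs
    rcases hs with ⟨rfl, rfl⟩ | ⟨rfl, rfl⟩
    · by_cases hyw : y = u
      · exact ⟨hyw.symm, hwv t (hyw ▸ hyt)⟩
      · by_cases htx : t = x
        · subst htx
          exact absurd ((hc.symm y t (hadj _ _ hyt hs')).symm.trans h.symm) (hγ y hxy hyw).1
        · exact absurd h.symm ((hγ y hxy hyw).2 t hyt htx)
    · obtain rfl := hwv y hxy
      exact absurd h.symm (hv' t hyt hs')
  refine ⟨c', fun x y h => ?_, fun x u t hu ht h => ?_, fun x y u t hxy hxu hyt h => ?_⟩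
  · by_cases hs : s(x, y) = s(v, w)
    · rw [e1 x y hs, e1 y x (by rw [Sym2.eq_swap, hs])]
    · rw [e2 x y hs, e2 y x (by rwa [Sym2.eq_swap])]
      exact hc.symm x y (hadj x y h hs)
  · have aux : ∀ u t, G.Adj x u → G.Adj x t → c' x u = c' x t → s(x, u) = s(v, w) → u = t := by
      clear h ht hu t u
      intro u t hu ht h hs
      by_cases hs' : s(x, t) = s(v, w)
      · rw [← hs'] at hs
        exact Sym2.congr_right.1 hs
      rw [e1 x u hs, e2 x t hs'] at h
      rw [Sym2.eq_iff] at hs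
      rcases hs with ⟨rfl, rfl⟩ | ⟨rfl, rfl⟩
      · exact absurd h.symm (hv' t ht hs')
      · rw [hwv t ht]
    by_cases hs : s(x, u) = s(v, w)
    · exact aux u t hu ht h hs
    by_cases hs' : s(x, t) = s(v, w)
    · exact (aux t u ht hu h.symm hs').symm
    rw [e2 x u hs, e2 x t hs'] at h
    exact hc.inj x u t (hadj _ _ hu hs) (hadj _ _ ht hs') h
  · by_cases hs : s(x, u) = s(v, w)
    · exact key x y u t hxy hxu hyt hs h
    by_cases hs' : s(y, t) = s(v, w)
    · exact (key y x t u hxy.symm hyt hxu hs' h.symm).symm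
    rw [e2 x u hs, e2 y t hs'] at h
    by_cases hs2 : s(x, y) = s(v, w)
    · -- the middle edge is the new one
      rw [Sym2.eq_iff] at hs2
      rcases hs2 with ⟨rfl, rfl⟩ | ⟨rfl, rfl⟩
      · obtain rfl := hwv t hyt
        exact absurd Sym2.eq_swap hs'
      · obtain rfl := hwv u hxu
        exact absurd Sym2.eq_swap hs
    · exact hc.edge x y u t (hadj _ _ hxy hs2) (hadj _ _ hxu hs) (hadj _ _ hyt hs') h

end

/-! ### Threads in sparse graphs -/

section
variable {V : Type*}

open Classical in
theorem card_darts_filter [Fintype V] (H : SimpleGraph V) (Q : V → Prop) :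
    (Finset.univ.filter fun p : V × V => H.Adj p.1 p.2 ∧ Q p.1).card =
      ∑ v ∈ Finset.univ.filter Q, deg H v := by
  rw [Finset.card_filter, Fintype.sum_prod_type, Finset.sum_filter]
  refine Finset.sum_congr rfl fun v _ => ?_
  by_cases hv : Q v
  · simp only [hv, and_true, if_true]
    rw [← Finset.card_filter, deg, ← Set.ncard_coe_finset]
    congr 1
    ext u
    simp
  · simp [hv]

theorem eq_of_deg_eq_two [Finite V] {H : SimpleGraph V} {v a b w : V} (h : deg H v = 2)
    (ha : H.Adj v a) (hb : H.Adj v b) (hw : H.Adj v w) (haw : a ≠ w) (hbw : b ≠ w) : a = b := by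
  by_contra hab
  have hsub : ({a, b, w} : Set V) ⊆ H.neighborSet v := by
    rintro x (rfl | rfl | rfl) <;> assumption
  have h1 := Set.ncard_le_ncard hsub (Set.toFinite _)
  rw [Set.ncard_eq_three.2 ⟨a, b, w, hab, haw, hbw, rfl⟩] at h1
  unfold deg at h
  omega

open Classical in
/-- A graph of minimum degree at least two with few edges contains a long walk without
backtracking through vertices of degree two. -/
theorem exists_thread [Fintype V] {H : SimpleGraph V} {W : Finset V} {l : ℕ} (hl : 1 ≤ l)
    (hHW : ∀ x y, H.Adj x y → x ∈ W) (hdeg : ∀ v ∈ W, 2 ≤ deg H v)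
    (hdens : (∑ v ∈ W, deg H v) * (3 * l) < 6 * l * W.card + ∑ v ∈ W, deg H v) :
    ∃ x : ℕ → V, (∀ i ≤ l, H.Adj (x i) (x (i + 1))) ∧
      ∀ i, 1 ≤ i → i ≤ l → x (i - 1) ≠ x (i + 1) ∧ deg H (x i) = 2 := by
  -- The walk entering a vertex of degree two is continued to its other neighbor; elsewhere the
  -- value is irrelevant.
  have hoth : ∀ p : V × V, ∃ w, H.Adj p.1 p.2 → deg H p.2 = 2 → H.Adj p.2 w ∧ w ≠ p.1 := by
    intro p
    by_cases h : H.Adj p.1 p.2 ∧ deg H p.2 = 2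
    · have : 1 < (H.neighborSet p.2).ncard := by have := h.2; unfold deg at this; omega
      obtain ⟨w, hw, hne⟩ := Set.exists_ne_of_one_lt_ncard this p.1
      exact ⟨w, fun _ _ => ⟨hw, hne⟩⟩
    · exact ⟨p.1, fun h1 h2 => absurd ⟨h1, h2⟩ h⟩
  choose oth hoth using hoth
  set step : V × V → V × V := fun p => (p.2, oth p) with hstep
  set big := Finset.univ.filter fun p : V × V => H.Adj p.1 p.2 ∧ deg H p.1 ≠ 2 with hbig
  -- Darts whose forward walk leaves the vertices of degree two for the first time at index `i`.
  set D : ℕ → Finset (V × V) := fun i => Finset.univ.filter fun p : V × V => H.Adj p.1 p.2 ∧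
    (∀ j < i, deg H (step^[j] p).1 = 2) ∧ deg H (step^[i] p).1 ≠ 2 with hD
  -- Walking forward is injective while the vertex passed has degree two, and the final dart
  -- reversed starts at a vertex of degree other than two.
  have hDcard : ∀ i, (D (i + 1)).card ≤ big.card := by
    intro i
    induction i with
    | zero =>
      refine Finset.card_le_card_of_injOn Prod.swap (fun p hp => ?_) (Prod.swap_injective.injOn)
      simp only [hD, hstep, Finset.coe_filter, Finset.mem_univ, true_and, Set.mem_ofPred_eq,
        Function.iterate_one, zero_add] at hp
      simp only [hbig, Finset.coe_filter, Finset.mem_univ, true_and, Set.mem_ofPred_eq,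
        Prod.fst_swap, Prod.snd_swap]
      exact ⟨hp.1.symm, hp.2.2⟩
    | succ i ih =>
      refine le_trans (Finset.card_le_card_of_injOn step (fun p hp => ?_) ?_) ih
      · simp only [hD, Finset.coe_filter, Finset.mem_univ, true_and, Set.mem_ofPred_eq] at hp ⊢
        obtain ⟨h1, h2, h3⟩ := hp
        have h4 : deg H p.2 = 2 := h2 1 (by omega)
        refine ⟨(hoth p h1 h4).1, fun j hj => ?_, ?_⟩
        · rw [← Function.iterate_succ_apply]
          exact h2 (j + 1) (by omega)
        · rwa [← Function.iterate_succ_apply]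
      · rintro ⟨a, v⟩ hp ⟨b, v'⟩ hq hpq
        simp only [hD, Finset.coe_filter, Finset.mem_univ, true_and, Set.mem_ofPred_eq] at hp hq
        have hv : v = v' := congrArg Prod.fst hpq
        subst hv
        have hw : oth (a, v) = oth (b, v) := congrArg Prod.snd hpq
        have h4 : deg H v = 2 := hp.2.1 1 (by omega)
        obtain ⟨h5, h6⟩ := hoth (a, v) hp.1 h4
        obtain ⟨h7, h8⟩ := hoth (b, v) hq.1 h4
        rw [← hw] at h8
        rw [eq_of_deg_eq_two h4 hp.1.symm hq.1.symm h5 h6.symm h8.symm]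
  by_contra hno
  -- Without a thread, every dart starting at a vertex of degree two meets another degree within `l
  -- - 1` steps.
  have hcover : (Finset.univ.filter fun p : V × V => H.Adj p.1 p.2 ∧ deg H p.1 = 2) ⊆
      (Finset.range (l - 1)).biUnion fun i => D (i + 1) := by
    intro p hp
    simp only [Finset.mem_filter, Finset.mem_univ, true_and] at hp
    by_contra hpD
    simp only [Finset.mem_biUnion, Finset.mem_range, not_exists, not_and] at hpD
    have hall : ∀ j, j < l → deg H (step^[j] p).1 = 2 := by
      intro j
      induction j using Nat.strong_induction_on with
      | _ j ih =>
        intro hj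
        by_contra hne
        obtain rfl | hj0 := Nat.eq_zero_or_pos j
        · exact hne hp.2
        · refine hpD (j - 1) (by omega) ?_
          simp only [hD, Finset.mem_filter, Finset.mem_univ, true_and]
          rw [Nat.sub_add_cancel hj0]
          exact ⟨hp.1, fun i hi => ih i hi (by omega), hne⟩
    have hsucc : ∀ i, (step^[i] p).2 = (step^[i + 1] p).1 := fun i => by
      rw [Function.iterate_succ_apply']
    have hadj : ∀ i, i < l → H.Adj (step^[i] p).1 (step^[i] p).2 := by
      intro i
      induction i with
      | zero => exact fun _ => hp.1
      | succ i ih =>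
        intro hi
        have h2 := hall (i + 1) hi
        rw [← hsucc] at h2
        have := (hoth _ (ih (by omega)) h2).1
        rw [Function.iterate_succ_apply']
        exact this
    obtain ⟨h5, h6⟩ := hoth p.swap hp.1.symm hp.2
    -- One vertex is added in front, the other neighbor of the first vertex.
    refine hno ⟨fun i => Nat.casesOn i (oth p.swap) fun i => (step^[i] p).1, ?_, ?_⟩
    · rintro (_ | i) hi
      · exact h5.symm
      · have := hadj i hi
        rwa [hsucc] at this
    · rintro (_ | _ | i) hi hil
      · omega
      · exact ⟨h6, hp.2⟩
      · refine ⟨?_, hall (i + 1) hil⟩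
        have h2 := hall (i + 1) hil
        rw [← hsucc] at h2
        have := (hoth _ (hadj i (by omega)) h2).2
        have h3 : (step^[i + 2] p).1 = oth (step^[i] p) := by
          rw [Function.iterate_succ_apply', Function.iterate_succ_apply']
        change (step^[i] p).1 ≠ (step^[i + 2] p).1
        rw [h3]
        exact this.symm
  have hWall : ∀ v, v ∉ W → deg H v = 0 := by
    intro v hv
    unfold deg
    rw [Set.ncard_eq_zero (Set.toFinite _)]
    exact Set.eq_empty_of_forall_notMem fun u hu => hv (hHW v u hu)
  have h2W : (Finset.univ.filter fun v => deg H v = 2) = W.filter fun v => deg H v = 2 := by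
    ext v
    simp only [Finset.mem_filter, Finset.mem_univ, true_and]
    refine ⟨fun h => ⟨?_, h⟩, fun h => h.2⟩
    by_contra hv
    rw [hWall v hv] at h
    omega
  have hn2 : (Finset.univ.filter fun p : V × V => H.Adj p.1 p.2 ∧ deg H p.1 = 2).card =
      ∑ v ∈ W.filter fun v => deg H v = 2, deg H v := by
    rw [← h2W]
    convert card_darts_filter H fun v => deg H v = 2
  rw [Finset.sum_const_nat (m := 2) (fun v hv => (Finset.mem_filter.1 hv).2)] at hn2
  have hB : big.card = ∑ v ∈ W.filter fun v => deg H v ≠ 2, deg H v := by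
    have : big.card = ∑ v ∈ Finset.univ.filter fun v => deg H v ≠ 2, deg H v := by
      rw [hbig]
      convert card_darts_filter H fun v => deg H v ≠ 2
    rw [this]
    refine (Finset.sum_subset (Finset.filter_subset_filter _ (Finset.subset_univ _)) ?_).symm
    intro v hv hvW
    refine hWall v fun h => hvW ?_
    exact Finset.mem_filter.2 ⟨h, (Finset.mem_filter.1 hv).2⟩
  have hB3 : (W.filter fun v => deg H v ≠ 2).card * 3 ≤ big.card := by
    rw [hB, ← smul_eq_mul]
    refine Finset.card_nsmul_le_sum _ _ _ fun v hv => ?_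
    obtain ⟨h1, h2⟩ := Finset.mem_filter.1 hv
    have := hdeg v h1
    omega
  have hS := Finset.sum_filter_add_sum_filter_not W (fun v => deg H v = 2) (deg H)
  have hWc := Finset.card_filter_add_card_filter_not (s := W) (fun v => deg H v = 2)
  rw [Finset.sum_const_nat (m := 2) (fun v hv => (Finset.mem_filter.1 hv).2), ← hB] at hS
  have hle := (Finset.card_le_card hcover).trans Finset.card_biUnion_le
  rw [hn2] at hle
  have hle2 := hle.trans (Finset.sum_le_card_nsmul _ _ _ fun i _ => hDcard i)
  rw [Finset.card_range, smul_eq_mul] at hle2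
  rw [← hS, ← hWc] at hdens
  change _ + (W.filter fun v => deg H v ≠ 2).card = _ at hWc
  change _ < 6 * l * (_ + (W.filter fun v => deg H v ≠ 2).card) + _ at hdens
  generalize (W.filter fun v => deg H v ≠ 2).card = n3 at *
  generalize (W.filter fun v => deg H v = 2).card = n2 at *
  generalize big.card = B at *
  obtain ⟨m, rfl⟩ : ∃ m, l = m + 1 := ⟨l - 1, by omega⟩
  rw [Nat.add_sub_cancel] at hle2
  -- With `B` darts at the `n3` vertices of degree at least three, `2 n2 ≤ (l - 1) B` and `3 n3 ≤
  -- B`, whereas the density bound reads `3 l B < 6 l n3 + 2 n2 + B`; the right side is at most `3 l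
  -- B`.
  have := Nat.mul_le_mul_left (m + 1) hB3
  nlinarith

end

/-! ### Color sets of at least the required size -/

section
variable {C : Type*} [DecidableEq C] [Fintype C]

/-- Sizes are raised to at least three, as the game requires. The sums of consecutive sizes stay at
most σ + 1 because every degree is at most σ - 2 and σ ≥ 5. -/
theorem exists_threadColoring_of_le {D : ℕ → ℕ} {A B : Finset C} {a b : C}
    (hC : 5 ≤ Fintype.card C) (ha : a ∈ A) (hb : b ∈ B)
    (hD : ∀ i ≤ ell (Fintype.card C) + 1, D i + 2 ≤ Fintype.card C)
    (hDD : ∀ i ≤ ell (Fintype.card C), D i + D (i + 1) ≤ Fintype.card C + 1)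
    (hAD : A.card ≤ D 0) (hBD : B.card ≤ D (ell (Fintype.card C) + 1)) :
    ∃ (E : ℕ → Finset C) (c : ℕ → C), A ⊆ E 0 ∧ B ⊆ E (ell (Fintype.card C) + 1) ∧ c 0 = a ∧
      c (ell (Fintype.card C)) = b ∧
      (∀ i, 1 ≤ i → i ≤ ell (Fintype.card C) → D i ≤ (E i).card) ∧
      IsThreadColoring (ell (Fintype.card C)) E c := by
  have hD0 := hD 0 (by omega)
  have hDl := hD _ le_rfl
  obtain ⟨A', hA, hA'⟩ := Finset.exists_superset_card_eq (s := A) (n := max 3 (D 0)) (by omega)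
    (by omega)
  obtain ⟨B', hB, hB'⟩ := Finset.exists_superset_card_eq (s := B)
    (n := max 3 (D (ell (Fintype.card C) + 1))) (by omega) (by omega)
  obtain ⟨E, c, h0, h1, h2, h3, h4, h5⟩ := exists_threadColoring (d := fun i => max 3 (D i)) hC
    (hA ha) (hB hb) (fun i hi => by have := hD i hi; omega)
    (fun i hi => by
      have := hD i (by omega)
      have := hD (i + 1) (by omega)
      have := hDD i hi
      omega) hA' hB'
  refine ⟨E, c, h0 ▸ hA, h1 ▸ hB, h2, h3, fun i hi hil => ?_, h5⟩
  rw [h4 i hi hil]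
  exact le_max_right _ _

/-- For `n = 7` the set at the base vertex needs four colors. If its degree is smaller, then, the
degree being maximal, its neighbors on the cycle need only three colors, and 4 + 3 ≤ σ + 1. -/
theorem exists_closed_threadColoring_of_le {n : ℕ} {D : ℕ → ℕ} {A : Finset C} {a b : C}
    (hC : 5 ≤ Fintype.card C) (ha : a ∈ A) (hb : b ∈ A) (hab : a ≠ b)
    (hn : (Even n ∧ 6 ≤ n) ∨ (Odd n ∧ 7 ≤ n ∧ Fintype.card C ≤ n))
    (hn7 : n = 7 → 6 ≤ Fintype.card C)
    (hD : ∀ i ≤ n, D i + 2 ≤ Fintype.card C)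
    (hDD : ∀ i < n, D i + D (i + 1) ≤ Fintype.card C + 1)
    (hAD : A.card ≤ D 0) (hDn : D n = D 0) (hmax : ∀ i ≤ n, D i ≤ D 0) :
    ∃ (E : ℕ → Finset C) (c : ℕ → C), A ⊆ E 0 ∧ A ⊆ E n ∧ c 0 = a ∧ c (n - 1) = b ∧
      (∀ i, 1 ≤ i → i < n → D i ≤ (E i).card) ∧ IsThreadColoring (n - 1) E c := by
  obtain ⟨k, hk, hk7⟩ : ∃ k, (k = 3 ∨ (k = 4 ∧ n = 7)) ∧ (n = 7 → k = 4) := by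
    by_cases h : n = 7
    · exact ⟨4, by omega, fun _ => rfl⟩
    · exact ⟨3, by omega, fun h' => absurd h' h⟩
  have hD0 := hD 0 (by omega)
  obtain ⟨A', hA, hA'⟩ := Finset.exists_superset_card_eq (s := A) (n := max k (D 0)) (by omega)
    (by omega)
  obtain ⟨E, c, h0, h1, h2, h3, h4, h5⟩ := exists_closed_threadColoring
    (d := fun i => if i = 0 ∨ i = n then max k (D i) else max 3 (D i))
    (hA ha) (hA hb) hab hn (fun h => by have := hk7 h; simp; omega)
    (fun i hi => by
      have := hD i hi
      split_ifs <;> omega)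
    (fun i hi => by
      have := hD i (by omega)
      have := hD (i + 1) (by omega)
      have := hDD i hi
      have := hmax i (by omega)
      have := hmax (i + 1) (by omega)
      obtain rfl | hi0 := Nat.eq_zero_or_pos i
      · rw [if_pos (Or.inl rfl), if_neg (by omega)]
        omega
      rw [if_neg (by omega)]
      obtain h | h := Nat.lt_or_ge (i + 1) n
      · rw [if_neg (by omega)]
        omega
      · rw [if_pos (by omega)]
        have : D (i + 1) = D 0 := by rw [show i + 1 = n by omega, hDn]
        omega) (by simpa using hA') (by simpa [hDn] using hA')
  refine ⟨E, c, h0 ▸ hA, h1 ▸ hA, h2, h3, fun i hi hil => ?_, h5⟩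
  rw [h4 i hi hil, if_neg (by omega)]
  exact le_max_right _ _

end

/-! ### Hereditary hypotheses; threads versus cycles -/

section
variable {V : Type*}

/-- The hereditary form of the hypotheses on the graph. -/
structure Sparse [Fintype V] (G : SimpleGraph V) (s : ℕ) : Prop where
  edge : ∀ x y, G.Adj x y → deg G x + deg G y ≤ s + 1
  deg_le : ∀ x, deg G x + 2 ≤ s
  -- The average degree bound `6ℓ / (3ℓ - 1)`, cleared of denominators.
  dens : ∀ H ≤ G, ∀ W : Finset V, W.Nonempty → (∀ x y, H.Adj x y → x ∈ W) →
    (∑ v ∈ W, deg H v) * (3 * ell s) < 6 * ell s * W.card + ∑ v ∈ W, deg H v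
  odd_cycle : ∀ (a : V) (w : G.Walk a a), w.IsCycle → Odd w.length → gPrime s ≤ w.length
  even_cycle : ∀ (a : V) (w : G.Walk a a), w.IsCycle → Even w.length → 6 ≤ w.length

theorem Sparse.mono [Fintype V] {G H : SimpleGraph V} {s : ℕ} (hG : Sparse G s) (h : H ≤ G) :
    Sparse H s where
  edge x y hxy := (Nat.add_le_add (deg_mono h x) (deg_mono h y)).trans (hG.edge x y (h hxy))
  deg_le x := (Nat.add_le_add_right (deg_mono h x) 2).trans (hG.deg_le x)
  dens H' hH' := hG.dens H' (hH'.trans h)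
  odd_cycle a w hw ho := by
    have := hG.odd_cycle a (w.mapLe h) (hw.mapLe h)
    simp only [Walk.length_mapLe] at this
    exact this ho
  even_cycle a w hw ho := by
    have := hG.even_cycle a (w.mapLe h) (hw.mapLe h)
    simp only [Walk.length_mapLe] at this
    exact this ho

/-- A closed walk through the residues modulo `n` without repetition gives a cycle. -/
theorem exists_isCycle_of_periodic {G : SimpleGraph V} {n : ℕ} (hn : 3 ≤ n) {y : ℕ → V}
    (hadj : ∀ t, G.Adj (y t) (y (t + 1))) (hy : ∀ t t', y t = y t' ↔ t ≡ t' [MOD n]) :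
    ∃ (a : V) (w : G.Walk a a), w.IsCycle ∧ w.length = n := by
  rw [← cycleGraph_isContained_iff hn]
  have key : ∀ u v : Fin n, (v - u).val = 1 → G.Adj (y u) (y v) := by
    intro u v h
    have : y v = y (u + 1) := by
      rw [hy]
      have hv : (v : ℕ) = ((u + (v - u) : Fin n) : ℕ) := by
        have : NeZero n := ⟨by omega⟩
        rw [add_sub_cancel]
      rw [Fin.val_add, h] at hv
      rw [hv]
      exact Nat.mod_modEq _ _
    rw [this]
    exact hadj u
  refine ⟨⟨⟨fun t : Fin n => y t, fun {u v} h => ?_⟩, fun u v h => ?_⟩⟩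
  · rcases cycleGraph_adj'.1 h with h | h
    · exact (key v u h).symm
    · exact key u v h
  · have h' : y u = y v := h
    rw [hy] at h'
    exact Fin.ext (Nat.ModEq.eq_of_lt_of_lt h' u.2 v.2)

/-- A walk without backtracking through vertices of degree two is a thread, or it runs around a
cycle consisting of vertices of degree two. -/
theorem thread_or_cycle {H : SimpleGraph V} {l : ℕ} {x : ℕ → V}
    (hadj : ∀ i ≤ l, H.Adj (x i) (x (i + 1)))
    (hx : ∀ i, 1 ≤ i → i ≤ l → x (i - 1) ≠ x (i + 1) ∧ deg H (x i) = 2) :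
    (∀ i j, 1 ≤ i → i ≤ l → j ≤ l + 1 → x i = x j → i = j) ∨
    ∃ (n : ℕ) (y : ℕ → V), 3 ≤ n ∧ (∀ t, H.Adj (y t) (y (t + 1))) ∧ (∀ t, deg H (y t) = 2) ∧
      ∀ t t', y t = y t' ↔ t ≡ t' [MOD n] := by
  classical
  -- The two ends of the walk are not compared: they may coincide without harm to the extension.
  by_cases hrep : ∃ n, 1 ≤ n ∧ n ≤ l ∧ ∃ i, i + n ≤ l + 1 ∧ x i = x (i + n)
  · right
    obtain ⟨hn1, hnl, i, hin, hi⟩ := Nat.find_spec hrep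
    have hmin := fun m => @Nat.find_min _ _ hrep m
    set n := Nat.find hrep with hn
    have hn3 : 3 ≤ n := by
      by_contra hlt
      obtain h1 | h2 : n = 1 ∨ n = 2 := by omega
      · rw [h1] at hi hin
        exact (hadj i (by omega)).ne hi
      · rw [h2] at hi hin
        exact (hx (i + 1) (by omega) (by omega)).1 hi
    have hinj : ∀ a b, a < b → b < n → x (i + a) ≠ x (i + b) := by
      intro a b hab hb h
      refine hmin (b - a) (by omega) ⟨by omega, by omega, i + a, by omega, ?_⟩
      rw [h]
      congr 1
      omega
    refine ⟨n, fun t => x (i + t % n), hn3, fun t => ?_, fun t => ?_, fun t t' => ?_⟩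
    · have ht := Nat.mod_lt t (show 0 < n by omega)
      have h1 : x (i + (t + 1) % n) = x (i + t % n + 1) := by
        rw [Nat.add_mod, Nat.mod_eq_of_lt (show 1 < n by omega)]
        obtain h | h := Nat.lt_or_ge (t % n + 1) n
        · rw [Nat.mod_eq_of_lt h, add_assoc]
        · have h2 : t % n + 1 = n := by omega
          rw [add_assoc, h2, Nat.mod_self, add_zero, hi]
      change H.Adj (x (i + t % n)) (x (i + (t + 1) % n))
      rw [h1]
      exact hadj _ (by omega)
    · have ht := Nat.mod_lt t (show 0 < n by omega)
      change deg H (x (i + t % n)) = 2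
      obtain h | h := Nat.eq_zero_or_pos (i + t % n)
      · have h0 : i = 0 := by omega
        have h1 : t % n = 0 := by omega
        rw [h1, add_zero, hi]
        exact (hx _ (by omega) (by omega)).2
      · exact (hx _ h (by omega)).2
    · have ht := Nat.mod_lt t (show 0 < n by omega)
      have ht' := Nat.mod_lt t' (show 0 < n by omega)
      change x (i + t % n) = x (i + t' % n) ↔ t % n = t' % n
      refine ⟨fun h => ?_, fun h => by rw [h]⟩
      by_contra hne
      obtain hlt | hlt := Nat.lt_or_gt_of_ne hne
      · exact hinj _ _ hlt ht' h
      · exact hinj _ _ hlt ht h.symm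
  · left
    intro i j hi hil hj hij
    by_contra hne
    obtain hlt | hlt := Nat.lt_or_gt_of_ne hne
    · exact hrep ⟨j - i, by omega, by omega, i, by omega, by rw [hij]; congr 1; omega⟩
    · exact hrep ⟨i - j, by omega, by omega, j, by omega, by rw [← hij]; congr 1; omega⟩

end

/-! ### The induction -/

section
variable {V : Type*}

theorem two_le_deg [Finite V] {G : SimpleGraph V} {v a b : V} (ha : G.Adj v a) (hb : G.Adj v b)
    (hab : a ≠ b) : 2 ≤ deg G v :=
  (Set.one_lt_ncard (Set.toFinite _)).2 ⟨a, ha, b, hb, hab⟩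

theorem exists_finset_colors [Finite V] {C : Type*} [DecidableEq C] (G : SimpleGraph V)
    (c : V → V → C) (v : V) :
    ∃ A : Finset C, (∀ u, G.Adj v u → c v u ∈ A) ∧ A.card ≤ deg G v := by
  have hfin : (c v '' G.neighborSet v).Finite := Set.toFinite _
  refine ⟨hfin.toFinset, fun u hu => ?_, ?_⟩
  · rw [Set.Finite.mem_toFinset]
    exact ⟨u, hu, rfl⟩
  · rw [← Set.ncard_eq_toFinset_card _ hfin]
    exact Set.ncard_image_le (Set.toFinite _)

/-- The vertices of degree at least two, with the edges between them. -/
def core (G : SimpleGraph V) : SimpleGraph V where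
  Adj x y := G.Adj x y ∧ 2 ≤ deg G x ∧ 2 ≤ deg G y
  symm := ⟨fun _ _ h => ⟨h.1.symm, h.2.2, h.2.1⟩⟩
  loopless := ⟨fun _ h => h.1.ne rfl⟩

theorem core_le (G : SimpleGraph V) : core G ≤ G := fun _ _ h => h.1

theorem eq_or_eq_of_core [Finite V] {G : SimpleGraph V} {v a b y : V} (hv : deg (core G) v = 2)
    (ha : (core G).Adj v a) (hb : (core G).Adj v b) (hab : a ≠ b) (hy : G.Adj v y)
    (hyd : 2 ≤ deg G y) : y = a ∨ y = b := by
  by_contra! h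
  exact h.1 (eq_of_deg_eq_two hv ⟨hy, ha.2.1, hyd⟩ ha hb h.2 hab)

theorem removePendant_edgeSet_ncard_lt [Finite V] {G : SimpleGraph V} {P : Set V} {a b : V}
    (hab : G.Adj a b) (ha : a ∈ P) (hb : b ∈ P) :
    (removePendant G P).edgeSet.ncard < G.edgeSet.ncard := by
  refine Set.ncard_lt_ncard ?_ (Set.toFinite _)
  refine ⟨edgeSet_mono (removePendant_le G P), fun h => ?_⟩
  have : (removePendant G P).Adj a b := h (show s(a, b) ∈ G.edgeSet from hab)
  exact this.2.1 ⟨ha, Or.inl hb⟩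

variable [Fintype V] {G : SimpleGraph V} {s : ℕ}

theorem Sparse.exists_localColoring_of_thread (hs : 5 ≤ s) (hG : Sparse G s) {x : ℕ → V}
    (hadj : ∀ i ≤ ell s, (core G).Adj (x i) (x (i + 1)))
    (hx : ∀ i, 1 ≤ i → i ≤ ell s → x (i - 1) ≠ x (i + 1) ∧ deg (core G) (x i) = 2)
    (hinj : ∀ i j, 1 ≤ i → i ≤ ell s → j ≤ ell s + 1 → x i = x j → i = j)
    (ih : ∀ H : SimpleGraph V, H.edgeSet.ncard < G.edgeSet.ncard → Sparse H s →
      ∃ c : V → V → Fin s, IsLocalColoring H c) :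
    ∃ c : V → V → Fin s, IsLocalColoring G c := by
  have hl : 2 ≤ ell s := by unfold ell; split_ifs <;> omega
  obtain ⟨c, hc⟩ := ih (removePendant G {v | ∃ i, 1 ≤ i ∧ i ≤ ell s ∧ x i = v})
    (removePendant_edgeSet_ncard_lt (hadj 1 (by omega)).1 ⟨1, le_rfl, by omega, rfl⟩
      ⟨2, by omega, by omega, rfl⟩) (hG.mono (removePendant_le _ _))
  have hdeg : ∀ i ≤ ell s + 1, 2 ≤ deg G (x i) := by
    intro i hi
    obtain h | rfl := Nat.lt_or_eq_of_le hi
    · exact (hadj i (by omega)).2.1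
    · exact (hadj _ le_rfl).2.2
  obtain ⟨A, hA, hAc⟩ := exists_finset_colors G c (x 0)
  obtain ⟨B, hB, hBc⟩ := exists_finset_colors G c (x (ell s + 1))
  obtain ⟨E, cs, h0, h1, h2, h3, h4, h5⟩ := exists_threadColoring_of_le (C := Fin s)
    (D := fun i => deg G (x i)) (by simpa using hs) (hA _ (hadj 0 (by omega)).1)
    (hB _ (hadj _ le_rfl).1.symm) (by simpa using fun i _ => hG.deg_le (x i))
    (by simpa using fun i hi => hG.edge _ _ (hadj i hi).1) hAc (by simpa using hBc)
  simp only [Fintype.card_fin] at h1 h3 h4 h5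
  refine hc.extend_thread (by omega) hinj hdeg (fun i hi => (hadj i hi).1)
    (fun i hi hil => (hx i hi hil).1) (fun i hi hil y hy hyd => ?_) h5 h4
    (fun u hu => h0 (hA u hu)) (fun u hu => h1 (hB u hu)) h2 h3
  have := (hadj (i - 1) (by omega)).symm
  rw [Nat.sub_add_cancel hi] at this
  exact eq_or_eq_of_core (hx i hi hil).2 this (hadj i hil) (hx i hi hil).1 hy hyd

/-- The cycle is cut at a vertex of maximum degree and treated as a thread with both ends there; the
girth conditions supply the length needed for closing up. -/
theorem Sparse.exists_localColoring_of_cycle (hs : 5 ≤ s) (hG : Sparse G s) {n : ℕ} {y : ℕ → V}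
    (hn : 3 ≤ n) (hadj : ∀ t, (core G).Adj (y t) (y (t + 1))) (hy2 : ∀ t, deg (core G) (y t) = 2)
    (hy : ∀ t t', y t = y t' ↔ t ≡ t' [MOD n])
    (ih : ∀ H : SimpleGraph V, H.edgeSet.ncard < G.edgeSet.ncard → Sparse H s →
      ∃ c : V → V → Fin s, IsLocalColoring H c) :
    ∃ c : V → V → Fin s, IsLocalColoring G c := by
  have hncond : ((Even n ∧ 6 ≤ n) ∨ (Odd n ∧ 7 ≤ n ∧ s ≤ n)) ∧ (n = 7 → 6 ≤ s) := by
    obtain ⟨a, w, hw, hwn⟩ := exists_isCycle_of_periodic hn (fun t => (hadj t).1) hy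
    have h1 := hG.odd_cycle a w hw
    have h2 := hG.even_cycle a w hw
    rw [hwn] at h1 h2
    obtain h | h := Nat.even_or_odd n
    · refine ⟨Or.inl ⟨h, h2 h⟩, ?_⟩
      rintro rfl
      exact absurd h (by decide)
    · have h3 := h1 h
      unfold gPrime at h3
      have h' := h
      obtain ⟨k, hk⟩ := h'
      split_ifs at h3 with h5
      · exact ⟨Or.inr ⟨h, by omega, by omega⟩, by omega⟩
      · exact ⟨Or.inr ⟨h, by omega, by omega⟩, by omega⟩
  obtain ⟨r, hr⟩ : ∃ r, ∀ t, deg G (y t) ≤ deg G (y r) := by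
    obtain ⟨r, -, hr⟩ := Finset.exists_max_image (Finset.range n) (fun t => deg G (y t))
      ⟨0, Finset.mem_range.2 (by omega)⟩
    refine ⟨r, fun t => ?_⟩
    have : y t = y (t % n) := (hy _ _).2 (Nat.mod_modEq t n).symm
    rw [this]
    exact hr _ (Finset.mem_range.2 (Nat.mod_lt _ (by omega)))
  set x : ℕ → V := fun i => y (r + i) with hxdef
  have hxadj : ∀ i, (core G).Adj (x i) (x (i + 1)) := fun i => hadj (r + i)
  have hxeq : ∀ i j, x i = x j ↔ i ≡ j [MOD n] := fun i j =>
    (hy _ _).trans ⟨fun h => Nat.ModEq.add_left_cancel' r h, fun h => h.add_left r⟩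
  have hxn : x n = x 0 := (hxeq _ _).2 (by simp [Nat.ModEq])
  have hinj : ∀ i j, 1 ≤ i → i ≤ n - 1 → j ≤ n - 1 + 1 → x i = x j → i = j := by
    intro i j hi hin hj h
    rw [hxeq] at h
    obtain hjn | rfl := Nat.lt_or_eq_of_le (show j ≤ n by omega)
    · exact h.eq_of_lt_of_lt (by omega) hjn
    · have : i % j = 0 := by rw [h, Nat.mod_self]
      rw [Nat.mod_eq_of_lt (by omega)] at this
      omega
  have hne : ∀ i, x i ≠ x (i + 2) := by
    intro i h
    rw [hxeq] at h
    have h2 : 0 ≡ 2 [MOD n] := Nat.ModEq.add_left_cancel' i h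
    have := h2.eq_of_lt_of_lt (by omega) (by omega)
    omega
  have hne' : ∀ i, 1 ≤ i → i ≤ n - 1 → x (i - 1) ≠ x (i + 1) := by
    intro i hi _ h
    refine hne (i - 1) ?_
    rwa [show i - 1 + 2 = i + 1 by omega]
  obtain ⟨c, hc⟩ := ih (removePendant G {v | ∃ i, 1 ≤ i ∧ i ≤ n - 1 ∧ x i = v})
    (removePendant_edgeSet_ncard_lt (hxadj 1).1 ⟨1, le_rfl, by omega, rfl⟩
      ⟨2, by omega, by omega, rfl⟩) (hG.mono (removePendant_le _ _))
  obtain ⟨A, hA, hAc⟩ := exists_finset_colors G c (x 0)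
  have hadjn : G.Adj (x 0) (x (n - 1)) := by
    have := (hxadj (n - 1)).1.symm
    rwa [show n - 1 + 1 = n by omega, hxn] at this
  have hx0 : x 0 ∉ {v | ∃ i, 1 ≤ i ∧ i ≤ n - 1 ∧ x i = v} := by
    rintro ⟨i, hi, hin, h⟩
    have := hinj i 0 hi hin (by omega) h
    omega
  have hd0 : 2 ≤ deg G (x 0) := (hxadj 0).2.1
  -- Both edges from the base vertex into the cycle survive in the reduced graph, so their colors
  -- differ.
  have hcc : c (x 0) (x 1) ≠ c (x 0) (x (n - 1)) := by
    intro h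
    have := hc.inj _ _ _ (removePendant_adj hx0 (hxadj 0).1 fun _ => hd0)
      (removePendant_adj hx0 hadjn fun _ => hd0) h
    have := hinj 1 (n - 1) le_rfl (by omega) (by omega) this
    omega
  obtain ⟨E, cs, h0, h1, h2, h3, h4, h5⟩ := exists_closed_threadColoring_of_le (C := Fin s) (n := n)
    (D := fun i => deg G (x i)) (by simpa using hs) (hA _ (hxadj 0).1) (hA _ hadjn) hcc
    (by simpa using hncond.1) (by simpa using hncond.2) (by simpa using fun i _ => hG.deg_le (x i))
    (by simpa using fun i _ => hG.edge _ _ (hxadj i).1) hAc (by simp [hxn])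
    (fun i _ => hr _)
  have hn1 : n - 1 + 1 = n := by omega
  refine hc.extend_thread (by omega) hinj (fun i _ => (hxadj i).2.1) (fun i _ => (hxadj i).1)
    hne' (fun i hi hin z hz hzd => ?_) h5 (fun i hi hin => h4 i hi (by omega))
    (fun u hu => h0 (hA u hu)) (fun u hu => ?_) h2 ?_
  · have := (hxadj (i - 1)).symm
    rw [Nat.sub_add_cancel hi] at this
    exact eq_or_eq_of_core (hy2 _) this (hxadj i) (hne' i hi hin) hz hzd
  · rw [hn1, hxn] at hu ⊢
    exact h1 (hA u hu)
  · rw [hn1, hxn, h3]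

theorem Sparse.exists_localColoring (hs : 5 ≤ s) (hG : Sparse G s) :
    ∃ c : V → V → Fin s, IsLocalColoring G c := by
  classical
  induction hm : G.edgeSet.ncard using Nat.strong_induction_on generalizing G with
  | _ m ih' =>
  have ih : ∀ H : SimpleGraph V, H.edgeSet.ncard < G.edgeSet.ncard → Sparse H s →
      ∃ c : V → V → Fin s, IsLocalColoring H c := fun H hH hHs => ih' _ (hm ▸ hH) hHs rfl
  by_cases hleaf : ∃ v w, G.Adj v w ∧ deg G w ≤ 1 ∧
      ∀ u u', G.Adj v u → G.Adj v u' → 2 ≤ deg G u → 2 ≤ deg G u' → u = u'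
  · obtain ⟨v, w, hvw, hw, hu⟩ := hleaf
    have hle : G.deleteEdges {s(v, w)} ≤ G := deleteEdges_le _
    have hlt : (G.deleteEdges {s(v, w)}).edgeSet.ncard < G.edgeSet.ncard := by
      rw [edgeSet_deleteEdges]
      exact Set.ncard_sdiff_singleton_lt_of_mem (show s(v, w) ∈ G.edgeSet from hvw)
        (Set.toFinite _)
    obtain ⟨c, hc⟩ := ih _ hlt (hG.mono hle)
    refine IsLocalColoring.extend_leaf hvw hw hu (fun u hu => ?_) ?_ hc
    · simpa using hG.edge v u hu
    · have := hG.deg_le v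
      simp only [Fintype.card_fin]
      omega
  push Not at hleaf
  by_cases hemp : ∀ a b, ¬ G.Adj a b
  · exact ⟨fun _ _ => ⟨0, by omega⟩, fun x y h => absurd h (hemp x y),
      fun x u v h => absurd h (hemp x u), fun x y u v h => absurd h (hemp x y)⟩
  push Not at hemp
  obtain ⟨a, b, hab⟩ := hemp
  have hW : (Finset.univ.filter fun v => 2 ≤ deg G v).Nonempty := by
    by_cases hb : deg G b ≤ 1
    · obtain ⟨u, u', hu, hu', h, -⟩ := hleaf a b hab hb
      exact ⟨u, by simpa using h⟩
    · exact ⟨b, by simp; omega⟩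
  have hHW : ∀ x y, (core G).Adj x y → x ∈ Finset.univ.filter fun v => 2 ≤ deg G v :=
    fun x y h => by simpa using h.2.1
  -- A vertex with a leaf neighbor has two non-leaf neighbors, since no pendant edge is reducible; a
  -- vertex without one keeps all its neighbors.
  have hdeg : ∀ v ∈ Finset.univ.filter fun v => 2 ≤ deg G v, 2 ≤ deg (core G) v := by
    intro v hv
    rw [Finset.mem_filter] at hv
    by_cases hw : ∃ w, G.Adj v w ∧ deg G w ≤ 1
    · obtain ⟨w, hvw, hw⟩ := hw
      obtain ⟨u, u', hu, hu', hd, hd', hne⟩ := hleaf v w hvw hw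
      exact two_le_deg (G := core G) ⟨hu, hv.2, hd⟩ ⟨hu', hv.2, hd'⟩ hne
    · push Not at hw
      refine hv.2.trans (Set.ncard_le_ncard (fun u hu => ?_) (Set.toFinite _))
      exact ⟨hu, hv.2, hw u hu⟩
  have hl : 1 ≤ ell s := by unfold ell; split_ifs <;> omega
  obtain ⟨x, hadj, hx⟩ := exists_thread hl hHW hdeg (hG.dens _ (core_le G) _ hW hHW)
  obtain hinj | ⟨n, y, hn, hyadj, hy2, hy⟩ := thread_or_cycle hadj hx
  · exact hG.exists_localColoring_of_thread hs hadj hx hinj ih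
  · exact hG.exists_localColoring_of_cycle hs hn hyadj hy2 hy ih

end

/-! ### Back to strong edge-colorings -/

section
variable {V : Type*} {G : SimpleGraph V}

theorem lineGraph_edist_le_one {e f : G.edgeSet} {x : V} (he : x ∈ e.1) (hf : x ∈ f.1) :
    G.lineGraph.edist e f ≤ 1 := by
  by_cases h : e = f
  · simp [h]
  · rw [SimpleGraph.edist_eq_one_iff_adj.2]
    exact ⟨h, x, he, hf⟩

/-- Two distinct edges at distance at most two share a vertex or are joined by an edge, which are
the two situations covered by a local coloring. -/
theorem IsLocalColoring.exists_isStrongEdgeColoring {k : ℕ} {c : V → V → Fin k}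
    (hc : IsLocalColoring G c) : ∃ c' : G.edgeSet → Fin k, IsStrongEdgeColoring G c' := by
  set c' : G.edgeSet → Fin k := fun e => c (Quot.out e.1).1 (Quot.out e.1).2 with hc'
  have key : ∀ (e : G.edgeSet) (a b : V), e.1 = s(a, b) → c' e = c a b := by
    intro e a b h
    have h1 : s((Quot.out e.1).1, (Quot.out e.1).2) = s(a, b) := by
      rw [← h]
      exact Quot.out_eq e.1
    have hab : G.Adj a b := by
      have := e.2
      rwa [h] at this
    rcases Sym2.eq_iff.1 h1 with ⟨h2, h3⟩ | ⟨h2, h3⟩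
    · simp only [hc', h2, h3]
    · simp only [hc', h2, h3]
      exact hc.symm b a hab.symm
  have hmem : ∀ (e : G.edgeSet) (x : V), x ∈ e.1 → ∃ u, e.1 = s(x, u) ∧ G.Adj x u := by
    intro e x hx
    obtain ⟨u, hu⟩ := hx
    refine ⟨u, hu, ?_⟩
    have := e.2
    rwa [hu] at this
  have hadj : ∀ (e f : G.edgeSet) (x : V), x ∈ e.1 → x ∈ f.1 → c' e = c' f → e = f := by
    intro e f x he hf h
    obtain ⟨u, hu, hxu⟩ := hmem e x he
    obtain ⟨v, hv, hxv⟩ := hmem f x hf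
    rw [key e x u hu, key f x v hv] at h
    obtain rfl := hc.inj x u v hxu hxv h
    exact Subtype.ext (hu.trans hv.symm)
  refine ⟨c', fun e f hef hdist h => hef ?_⟩
  obtain ⟨p, hp⟩ := SimpleGraph.exists_walk_of_edist_ne_top (ne_top_of_le_ne_top (by simp) hdist)
  rw [← hp] at hdist
  have hp2 : p.length ≤ 2 := by exact_mod_cast hdist
  match p with
  | .nil => rfl
  | .cons h1 .nil =>
    obtain ⟨-, x, hx, hx'⟩ := h1
    exact hadj e f x hx hx' h
  | .cons (v := g) h1 (.cons h2 .nil) =>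
    obtain ⟨-, x, hx, hx'⟩ := h1
    obtain ⟨-, y, hy, hy'⟩ := h2
    by_cases hxy : x = y
    · subst hxy
      exact hadj e f x hx hy' h
    · have hg : g.1 = s(x, y) := (Sym2.mem_and_mem_iff hxy).1 ⟨hx', hy⟩
      obtain ⟨u, hu, hxu⟩ := hmem e x hx
      obtain ⟨v, hv, hyv⟩ := hmem f y hy'
      have hgadj : G.Adj x y := by
        have := g.2
        rwa [hg] at this
      rw [key e x u hu, key f y v hv] at h
      obtain ⟨rfl, rfl⟩ := hc.edge x y u v hgadj hxu hyv h
      exact Subtype.ext (hu.trans (Sym2.eq_swap.trans hv.symm))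
  | .cons _ (.cons _ (.cons _ _)) => simp at hp2

theorem deg_eq_degree [Fintype V] [DecidableRel G.Adj] (v : V) : deg G v = G.degree v := by
  rw [deg, Set.ncard_eq_toFinset_card', ← SimpleGraph.card_neighborSet_eq_degree, Set.toFinset_card]

/-- All edges meeting `xy` are within distance one of `xy`, hence pairwise within distance two and
differently colored. -/
theorem IsStrongEdgeColoring.deg_add_deg_le [Finite V] {k : ℕ} {c : G.edgeSet → Fin k}
    (hc : IsStrongEdgeColoring G c) {x y : V} (hxy : G.Adj x y) : deg G x + deg G y ≤ k + 1 := by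
  classical
  have := Fintype.ofFinite V
  have hinc : ∀ v, (G.incidenceSet v).ncard = deg G v := by
    intro v
    rw [deg_eq_degree, ← SimpleGraph.card_incidenceSet_eq_degree, Set.ncard_eq_toFinset_card',
      Set.toFinset_card]
  have hU := Set.ncard_union_add_ncard_inter (G.incidenceSet x) (G.incidenceSet y)
    (Set.toFinite _) (Set.toFinite _)
  rw [SimpleGraph.incidenceSet_inter_incidenceSet_of_adj G hxy, Set.ncard_singleton, hinc,
    hinc] at hU
  set S : Set G.edgeSet := {e | x ∈ e.1 ∨ y ∈ e.1} with hS
  have hSU : S.ncard = (G.incidenceSet x ∪ G.incidenceSet y).ncard := by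
    rw [← Set.ncard_image_of_injective S Subtype.val_injective]
    congr 1
    ext e
    simp only [hS, Set.mem_image, Set.mem_ofPred_eq, Subtype.exists, exists_and_right,
      exists_eq_right, Set.mem_union, SimpleGraph.incidenceSet]
    constructor
    · rintro ⟨he, h⟩
      exact h.imp (fun h => ⟨he, h⟩) (fun h => ⟨he, h⟩)
    · rintro (⟨he, h⟩ | ⟨he, h⟩)
      · exact ⟨he, Or.inl h⟩
      · exact ⟨he, Or.inr h⟩
  have hinj : Set.InjOn c S := by
    intro e he f hf h
    by_contra hef
    refine hc e f hef ?_ h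
    set g : G.edgeSet := ⟨s(x, y), hxy⟩
    have h1 : ∀ e ∈ S, G.lineGraph.edist e g ≤ 1 := by
      rintro e (he | he)
      · exact lineGraph_edist_le_one he (Sym2.mem_mk_left x y)
      · exact lineGraph_edist_le_one he (Sym2.mem_mk_right x y)
    calc G.lineGraph.edist e f ≤ G.lineGraph.edist e g + G.lineGraph.edist g f :=
          SimpleGraph.edist_triangle
      _ ≤ 1 + 1 := add_le_add (h1 e he) (by rw [SimpleGraph.edist_comm]; exact h1 f hf)
      _ = 2 := one_add_one_eq_two
  have hk : (c '' S).ncard ≤ k := by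
    have := Set.ncard_le_ncard (Set.subset_univ (c '' S)) (Set.toFinite _)
    rwa [Set.ncard_univ, Nat.card_eq_fintype_card, Fintype.card_fin] at this
  rw [hinj.ncard_image] at hk
  omega

theorem Sparse.of_girth_of_mad [Fintype V] [DecidableRel G.Adj]
    (hDelta : G.maxDegree + 2 ≤ sigma G) (hodd : (gPrime (sigma G) : ℕ∞) ≤ oddGirth G)
    (heven : 6 ≤ evenGirth G) (hmad : mad G < 2 + 2 / (3 * (ell (sigma G) : ℝ) - 1))
    (hs : 5 ≤ sigma G) : Sparse G (sigma G) where
  edge x y hxy := by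
    have := Finset.le_sup (f := fun p : V × V => G.degree p.1 + G.degree p.2 - 1)
      (show (x, y) ∈ Finset.univ.filter fun p : V × V => G.Adj p.1 p.2 by simpa using hxy)
    rw [deg_eq_degree, deg_eq_degree]
    change G.degree x + G.degree y - 1 ≤ sigma G at this
    omega
  deg_le x := by
    rw [deg_eq_degree]
    have := G.degree_le_maxDegree x
    omega
  dens H hH W hW hHW := by
    classical
    set K : G.Subgraph :=
      { verts := W
        Adj := H.Adj
        adj_sub := fun h => hH h
        edge_vert := fun h => hHW _ _ h
        symm := ⟨fun _ _ h => h.symm⟩ } with hK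
    have hle : 2 * (K.edgeSet.ncard : ℝ) / (K.verts.ncard : ℝ) ≤ mad G :=
      le_ciSup (f := fun K : G.Subgraph => 2 * (K.edgeSet.ncard : ℝ) / (K.verts.ncard : ℝ))
        (Set.finite_range _).bddAbove K
    have hKe : K.edgeSet = H.edgeSet := by
      ext e
      induction e with | _ a b => rfl
    have hKv : K.verts.ncard = W.card := Set.ncard_coe_finset W
    have hsum : ∑ v ∈ W, deg H v = 2 * H.edgeSet.ncard := by
      have h1 : ∑ v ∈ W, deg H v = ∑ v, deg H v := by
        refine Finset.sum_subset (Finset.subset_univ W) fun v _ hv => ?_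
        unfold deg
        rw [Set.ncard_eq_zero (Set.toFinite _)]
        exact Set.eq_empty_of_forall_notMem fun u hu => hv (hHW v u hu)
      rw [h1, Finset.sum_congr rfl fun v _ => deg_eq_degree v,
        SimpleGraph.sum_degrees_eq_twice_card_edges, Set.ncard_eq_toFinset_card']
      rfl
    have hl : 1 ≤ ell (sigma G) := by unfold ell; split_ifs <;> omega
    have hlR : (1 : ℝ) ≤ (ell (sigma G) : ℝ) := by exact_mod_cast hl
    have hWR : (0 : ℝ) < (W.card : ℝ) := by exact_mod_cast hW.card_pos
    rw [hKe, hKv] at hle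
    have hlt := hle.trans_lt hmad
    have hpos : (0 : ℝ) < 3 * (ell (sigma G) : ℝ) - 1 := by linarith
    rw [show (2 : ℝ) + 2 / (3 * (ell (sigma G) : ℝ) - 1) =
      6 * (ell (sigma G) : ℝ) / (3 * (ell (sigma G) : ℝ) - 1) by field_simp; ring,
      div_lt_div_iff₀ hWR hpos] at hlt
    rw [hsum]
    have : ((2 * H.edgeSet.ncard * (3 * ell (sigma G)) : ℕ) : ℝ) <
        ((6 * ell (sigma G) * W.card + 2 * H.edgeSet.ncard : ℕ) : ℝ) := by
      push_cast
      linarith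
    exact_mod_cast this
  odd_cycle a w hw ho := by
    have h1 : oddGirth G ≤ w.length :=
      iInf_le_of_le a (iInf_le_of_le w (iInf_le_of_le hw (iInf_le_of_le ho le_rfl)))
    exact_mod_cast hodd.trans h1
  even_cycle a w hw he := by
    have h1 : evenGirth G ≤ w.length :=
      iInf_le_of_le a (iInf_le_of_le w (iInf_le_of_le hw (iInf_le_of_le he le_rfl)))
    exact_mod_cast heven.trans h1

end

end StrongEdge

theorem mainTheorem4 {V : Type*} [Fintype V] (G : SimpleGraph V) [DecidableRel G.Adj]
    (hsigma : 5 ≤ StrongEdge.sigma G)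
    (hDelta : G.maxDegree + 2 ≤ StrongEdge.sigma G)
    (hodd : (StrongEdge.gPrime (StrongEdge.sigma G) : ℕ∞) ≤ StrongEdge.oddGirth G)
    (heven : 6 ≤ StrongEdge.evenGirth G)
    (hmad : StrongEdge.mad G < 2 + 2 / (3 * (StrongEdge.ell (StrongEdge.sigma G) : ℝ) - 1)) :
    StrongEdge.strongChromaticIndex G = (StrongEdge.sigma G : ℕ∞) := by
  refine le_antisymm ?_ (le_iInf₂ fun k hk => ?_)
  · obtain ⟨c, hc⟩ := (StrongEdge.Sparse.of_girth_of_mad hDelta hodd heven hmad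
      hsigma).exists_localColoring hsigma
    exact iInf₂_le (f := fun (k : ℕ) (_ : k ∈ {k : ℕ | ∃ c : G.edgeSet → Fin k,
      StrongEdge.IsStrongEdgeColoring G c}) => (k : ℕ∞)) _ hc.exists_isStrongEdgeColoring
  · obtain ⟨c, hc⟩ := hk
    rw [Nat.cast_le]
    refine Finset.sup_le fun p hp => ?_
    have := hc.deg_add_deg_le (Finset.mem_filter.1 hp).2
    rw [StrongEdge.deg_eq_degree, StrongEdge.deg_eq_degree] at this
    omega
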